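/- Let $n\ge 2$, $s\in(0,1)$ and $0<\lambda\le\Lambda$. There is a constant $C=C(n,s,\lambda,\Lambda)$ with the following property. Let $K$ be a kernel in the class $\mathcal L_2(s,\lambda,\Lambda)$, that is, $K(z)=K(-z)$, and for all $z\in\mathbb R^n\setminus\{0\}$ and all unit vectors $e$, $$\frac{\lambda}{|z|^{n+s}}\le K(z)\le\frac{\Lambda}{|z|^{n+s}},\qquad \max\bigl\{|z|\,|\partial_eK(z)|,\ |z|^2\,|\partial_{ee}K(z)|\bigr\}\le\frac{\Lambda}{|z|^{n+s}},$$ where the derivatives $\partial_eK(z)$, $\partial_{ee}K(z)$ are assumed to exist. For measurable sets put $L_K(A,B)=\int_A\int_B K(x-\bar x)\,d\bar x\,dx$ and, with $\mathcal CE=\mathbb R^n\setminus E$, $$P_{K,\Omega}(E)=L_K(E\cap\Omega,\mathcal CE\cap\Omega)+L_K(E\cap\Omega,\mathcal CE\setminus\Omega)+L_K(E\setminus\Omega,\mathcal CE\cap\Omega).$$ Let $B_r$ be the open ball of radius $r$ centred at $0$, and let $E\subset\mathbb R^n$ be a measurable set that is stable for $P_{K,B_4}$, that is: $P_{K,B_4}(E)<\infty$,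 and for every vector field $X=X(x,t)\in C^2_c(B_4\times(-1,1);\mathbb R^n)$ and every $\varepsilon>0$ there is $t_0>0$ such that, denoting by $\Psi_t$ the integral flow of $X$ ($\Psi_0=\mathrm{id}$, $\partial_t\Psi_t(x)=X(\Psi_t(x),t)$) and $F_t=\Psi_t(E)$, $$0\le P_{K,B_4}(F_t\cup E)-P_{K,B_4}(E)+\varepsilon t^2\quad\text{and}\quad 0\le P_{K,B_4}(F_t\cap E)-P_{K,B_4}(E)+\varepsilon t^2\qquad\text{for all }t\in(-t_0,t_0).$$ Then $\chi_E\in BV(B_1)$ and $$\mathrm{Per}_{B_1}(E)=|\nabla\chi_E|(B_1)=\sup\Bigl\{\int_{B_1}\chi_E\,\mathrm{div}\,\phi\,dx\ :\ \phi\in C^1_c(B_1;\mathbb R^n),\ |\phi|\le1\Bigr\}\le C.$$ -/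

import Mathlib

open MeasureTheory Set
open scoped ENNReal NNReal

namespace NonlocalPerimeter

noncomputable section

/-- The Euclidean space `ℝⁿ`. -/
abbrev Rn (n : ℕ) : Type := EuclideanSpace ℝ (Fin n)

/-! ### Kernels and the nonlocal perimeter -/

/-- The class `𝓛₂(s, lam, Lam)` of even kernels on `ℝⁿ ∖ {0}` comparable to `|z|^{-(n+s)}`, which
have first and second derivatives `∂ₑK`, `∂ₑₑK` in every unit direction `e` at every `z ≠ 0`,
controlled by `Lam |z|^{-(n+s)-1}` and `Lam |z|^{-(n+s)-2}`. The value `K 0` plays no role. -/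
structure KernelClassL2 {n : ℕ} (s lam Lam : ℝ) (K : Rn n → ℝ) : Prop where
  even : ∀ z : Rn n, K (-z) = K z
  lower : ∀ z : Rn n, z ≠ 0 → lam / ‖z‖ ^ ((n : ℝ) + s) ≤ K z
  upper : ∀ z : Rn n, z ≠ 0 → K z ≤ Lam / ‖z‖ ^ ((n : ℝ) + s)
  lineDiff : ∀ z e : Rn n, z ≠ 0 → ‖e‖ = 1 → LineDifferentiableAt ℝ K z e
  lineDiff₂ : ∀ z e : Rn n, z ≠ 0 → ‖e‖ = 1 →
    LineDifferentiableAt ℝ (fun y => lineDeriv ℝ K y e) z e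
  deriv_bound : ∀ z e : Rn n, z ≠ 0 → ‖e‖ = 1 →
    max (‖z‖ * |lineDeriv ℝ K z e|)
      (‖z‖ ^ 2 * |lineDeriv ℝ (fun y => lineDeriv ℝ K y e) z e|) ≤ Lam / ‖z‖ ^ ((n : ℝ) + s)

/-- The interaction `L_K(A, B) = ∫_A ∫_B K(x - y) dy dx`, with values in `[0, ∞]`. -/
def interaction {n : ℕ} (K : Rn n → ℝ) (A B : Set (Rn n)) : ℝ≥0∞ :=
  ∫⁻ x in A, ∫⁻ y in B, ENNReal.ofReal (K (x - y))

/-- The `K`-perimeter `P_{K,Ω}(E)` of `E` inside `Ω`. -/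
def kPerimeter {n : ℕ} (K : Rn n → ℝ) (Ω E : Set (Rn n)) : ℝ≥0∞ :=
  interaction K (E ∩ Ω) (Eᶜ ∩ Ω) + interaction K (E ∩ Ω) (Eᶜ \ Ω)
    + interaction K (E \ Ω) (Eᶜ ∩ Ω)

/-! ### Stable sets -/

/-- `X ∈ C²_c(Ω × (-1,1); ℝⁿ)`: a time-dependent vector field of class `C²` with compact support
contained in `Ω × (-1,1)`. -/
structure IsAdmissibleField {n : ℕ} (Ω : Set (Rn n)) (X : Rn n × ℝ → Rn n) : Prop where
  contDiff : ContDiff ℝ 2 X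
  compactSupport : HasCompactSupport X
  tsupport_subset : tsupport X ⊆ Ω ×ˢ Ioo (-1 : ℝ) 1

/-- `Ψ` is the integral flow of the time-dependent field `X`, for times in `(-1,1)`:
`Ψ₀ = id` and `∂ₜ Ψₜ(x) = X(Ψₜ(x), t)`. -/
structure IsIntegralFlow {n : ℕ} (X : Rn n × ℝ → Rn n) (Ψ : ℝ → Rn n → Rn n) : Prop where
  zero : ∀ x, Ψ 0 x = x
  deriv : ∀ x, ∀ t ∈ Ioo (-1 : ℝ) 1, HasDerivAt (fun τ => Ψ τ x) (X (Ψ t x, t)) t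

/-- `E` is a stable set for `P_{K,Ω}`: its `K`-perimeter in `Ω` is finite, and for every admissible
field with flow `Ψ` and every `ε > 0` there is `t₀ > 0` such that for `|t| < t₀`, with
`Fₜ = Ψₜ(E)`, both `P(Fₜ ∪ E) - P(E) + ε t²` and `P(Fₜ ∩ E) - P(E) + ε t²` are nonnegative
(here `P(E) < ∞`, so `P(E)` may be moved to the other side). -/
def IsStableSet {n : ℕ} (K : Rn n → ℝ) (Ω E : Set (Rn n)) : Prop :=
  kPerimeter K Ω E < ∞ ∧
  ∀ X : Rn n × ℝ → Rn n, IsAdmissibleField Ω X →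
  ∀ Ψ : ℝ → Rn n → Rn n, IsIntegralFlow X Ψ →
  ∀ ε : ℝ, 0 < ε → ∃ t₀ : ℝ, 0 < t₀ ∧ ∀ t ∈ Ioo (-t₀) t₀,
    kPerimeter K Ω E ≤ kPerimeter K Ω (Ψ t '' E ∪ E) + ENNReal.ofReal (ε * t ^ 2) ∧
    kPerimeter K Ω E ≤ kPerimeter K Ω (Ψ t '' E ∩ E) + ENNReal.ofReal (ε * t ^ 2)

/-! ### Functions of bounded variation and the classical perimeter -/

/-- The divergence of a vector field on `ℝⁿ`. -/
def divergence {n : ℕ} (φ : Rn n → Rn n) (x : Rn n) : ℝ :=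
  ∑ i : Fin n, (fderiv ℝ φ x (EuclideanSpace.single i 1)) i

/-- The competitors in the total variation: `φ ∈ C¹_c(Ω; ℝⁿ)` with `|φ| ≤ 1`. -/
structure IsTestField {n : ℕ} (Ω : Set (Rn n)) (φ : Rn n → Rn n) : Prop where
  contDiff : ContDiff ℝ 1 φ
  compactSupport : HasCompactSupport φ
  tsupport_subset : tsupport φ ⊆ Ω
  norm_le_one : ∀ x, ‖φ x‖ ≤ 1

/-- The total variation `|∇u|(Ω) = sup ∫_Ω u div φ` in `[0, ∞]`, for `u ∈ L¹(Ω)`. Since `φ = 0` is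
a competitor, truncating the integrals at `0` does not change the supremum. -/
def totalVariation {n : ℕ} (u : Rn n → ℝ) (Ω : Set (Rn n)) : ℝ≥0∞ :=
  ⨆ (φ : Rn n → Rn n) (_ : IsTestField Ω φ),
    ENNReal.ofReal (∫ x in Ω, u x * divergence φ x)

/-- `u ∈ BV(Ω)`. -/
def MemBV {n : ℕ} (u : Rn n → ℝ) (Ω : Set (Rn n)) : Prop :=
  IntegrableOn u Ω ∧ totalVariation u Ω < ∞

/-- The characteristic function `χ_E`. -/
def charFun {n : ℕ} (E : Set (Rn n)) : Rn n → ℝ := E.indicator fun _ => 1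

/-- The classical perimeter `Per_Ω(E) = |∇χ_E|(Ω)`. -/
def perimeter {n : ℕ} (Ω E : Set (Rn n)) : ℝ≥0∞ := totalVariation (charFun E) Ω

end

end NonlocalPerimeter

namespace NonlocalPerimeter

/-! ### Regularity of kernels along lines -/

/-! Fix a unit vector e and a cutoff η, and let F_t be the image of E under x ↦ x + tη(x)e. Along
this motion differences of points move on straight lines and Jacobians are affine in t, so adding
the perimeters of F_t and F_{-t} cancels the first order. The kernel bounds leave an excess over
2P(E) of order t²|∇η|² P_{B_R}(E), with B_R just larger than the support of η
(`kPerimeter_shear_add_le`). Submodularity with its defect term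
(`kPerimeter_union_add_inter_add_le`) and stability then bound the interaction of F_t \ E with E \
F_t by the same quantity plus an ε t² error (`IsShearStable.interaction_le`).

Where η = 1 the set F_t is a translate of E. The kernel is bounded below at bounded distances, so
the volumes a and b of the parts of B_r gained and lost satisfy ab = O(t²). Also |a - b| = O(t),
since translation changes volume in a ball only through a thin shell. Hence a + b = O(t): a BV-type
bound whose constant is the square root of 1 + P_{B_R}(E)/(R-r)²
(`exists_volume_jumpSet_le_of_kPerimeter_le`).

Conversely, a linear bound w|h| on translation differences controls the nonlocal perimeter linearly
in w, because |h|^{1-n-s} is integrable at 0 when s < 1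
(`exists_kPerimeter_le_of_volume_jumpSet_le`). Together the BV-type constant on B_r is at most the
square root of an affine function of the one on B_R. Sublinear growth lets it be absorbed over
shrinking balls, leaving a universal constant on B_1 (`exists_hasJumpBound_one`). Difference
quotients turn this into a bound on the total variation (`HasJumpBound.totalVariation_le`). -/

theorem hasDerivAt_of_lineDifferentiableAt {n : ℕ} {f : Rn n → ℝ} {z e : Rn n} {τ : ℝ}
    (h : LineDifferentiableAt ℝ f (z + τ • e) e) :
    HasDerivAt (fun σ : ℝ => f (z + σ • e)) (lineDeriv ℝ f (z + τ • e) e) τ := by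
  have h1 : HasDerivAt (fun t : ℝ => f (z + τ • e + t • e)) (lineDeriv ℝ f (z + τ • e) e) (τ - τ) := by
    rw [sub_self]; exact h.hasLineDerivAt
  have h2 := h1.comp_sub_const τ τ
  refine h2.congr_of_eventuallyEq (Filter.Eventually.of_forall fun σ => ?_)
  have : z + τ • e + (σ - τ) • e = z + σ • e := by module
  simp only [this]

/-- First and second symmetric differences of a twice differentiable function. -/
theorem abs_symmetric_differences_le {f f' f'' : ℝ → ℝ} {ρ D₁ D₂ : ℝ}
    (hf : ∀ σ, |σ| ≤ ρ → HasDerivAt f (f' σ) σ) (hf' : ∀ σ, |σ| ≤ ρ → HasDerivAt f' (f'' σ) σ)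
    (h₁ : ∀ σ, |σ| ≤ ρ → |f' σ| ≤ D₁) (h₂ : ∀ σ, |σ| ≤ ρ → |f'' σ| ≤ D₂)
    {τ : ℝ} (hτ : |τ| ≤ ρ) :
    |f τ - f (-τ)| ≤ 2 * D₁ * |τ| ∧ |f τ + f (-τ) - 2 * f 0| ≤ 2 * D₂ * τ ^ 2 := by
  have hconv : Convex ℝ (Icc (-|τ|) |τ|) := convex_Icc _ _
  have hmem : ∀ σ ∈ Icc (-|τ|) |τ|, |σ| ≤ ρ := fun σ hσ => (abs_le.2 hσ).trans hτ
  have hmem' : ∀ σ, |σ| ≤ |τ| → σ ∈ Icc (-|τ|) |τ| := fun σ hσ => abs_le.1 hσ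
  have e0 : ∀ σ : ℝ, |σ - -σ| = 2 * |σ| := fun σ => by
    rw [sub_neg_eq_add, ← two_mul, abs_mul, abs_two]
  constructor
  · have := hconv.norm_image_sub_le_of_norm_hasDerivWithin_le (f := f) (f' := f') (C := D₁)
      (fun x hx => (hf x (hmem x hx)).hasDerivWithinAt) (fun x hx => h₁ x (hmem x hx))
      (hmem' (-τ) (by simp)) (hmem' τ le_rfl)
    rw [Real.norm_eq_abs, Real.norm_eq_abs, e0] at this
    linarith
  -- The even part of f has derivative f'(σ) - f'(-σ), again a symmetric difference, so the mean
  -- value inequality is applied twice.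
  · have hg : ∀ σ ∈ Icc (-|τ|) |τ|,
        HasDerivWithinAt (fun σ => f σ + f (-σ)) (f' σ - f' (-σ)) (Icc (-|τ|) |τ|) σ := by
      intro σ hσ
      have h3 : HasDerivAt (fun σ => f (-σ)) (-f' (-σ)) σ := by
        have := (hf (-σ) (by rw [abs_neg]; exact hmem σ hσ)).comp σ (hasDerivAt_neg σ)
        rwa [mul_neg_one] at this
      rw [sub_eq_add_neg]
      exact ((hf σ (hmem σ hσ)).add h3).hasDerivWithinAt
    have hb : ∀ σ ∈ Icc (-|τ|) |τ|, ‖f' σ - f' (-σ)‖ ≤ 2 * D₂ * |τ| := by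
      intro σ hσ
      have hn : -σ ∈ Icc (-|τ|) |τ| := hmem' _ (by rw [abs_neg]; exact abs_le.2 hσ)
      have := hconv.norm_image_sub_le_of_norm_hasDerivWithin_le (f := f') (f' := f'') (C := D₂)
        (fun x hx => (hf' x (hmem x hx)).hasDerivWithinAt) (fun x hx => h₂ x (hmem x hx)) hn hσ
      rw [Real.norm_eq_abs (σ - -σ), e0] at this
      have hD : 0 ≤ D₂ := (abs_nonneg _).trans (h₂ σ (hmem σ hσ))
      have h4 : D₂ * (2 * |σ|) ≤ 2 * D₂ * |τ| := by
        have := mul_le_mul_of_nonneg_left (abs_le.2 hσ) hD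
        linarith
      exact this.trans h4
    have := hconv.norm_image_sub_le_of_norm_hasDerivWithin_le hg hb
      (hmem' 0 (by simp)) (hmem' τ le_rfl)
    simp only [Real.norm_eq_abs, neg_zero, sub_zero] at this
    have e1 : f τ + f (-τ) - 2 * f 0 = f τ + f (-τ) - (f 0 + f 0) := by ring
    rw [e1]
    have e2 : τ ^ 2 = |τ| * |τ| := by rw [abs_mul_abs_self, sq]
    rw [e2]; linarith

/-! ### Consequences of the kernel bounds -/

namespace KernelClassL2

variable {n : ℕ} {s lam Lam : ℝ} {K : Rn n → ℝ}

theorem Lam_nonneg_of_ne (hK : KernelClassL2 s lam Lam K) (hlam : 0 < lam) {z : Rn n}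
    (hz : z ≠ 0) : 0 ≤ Lam := by
  have hr : (0 : ℝ) < ‖z‖ ^ ((n : ℝ) + s) := Real.rpow_pos_of_pos (norm_pos_iff.2 hz) _
  have := (hK.lower z hz).trans (hK.upper z hz)
  rw [div_le_div_iff_of_pos_right hr] at this
  linarith

theorem pos (hK : KernelClassL2 s lam Lam K) (hlam : 0 < lam) {z : Rn n} (hz : z ≠ 0) :
    0 < K z :=
  lt_of_lt_of_le (div_pos hlam (Real.rpow_pos_of_pos (norm_pos_iff.2 hz) _)) (hK.lower z hz)

theorem abs_lineDeriv_le (hK : KernelClassL2 s lam Lam K) (hs : 0 < s) (hLam : 0 ≤ Lam)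
    {w e : Rn n} (he : ‖e‖ = 1) {r : ℝ} (hr : 0 < r) (hw : r ≤ ‖w‖) :
    |lineDeriv ℝ K w e| ≤ Lam / (r ^ ((n : ℝ) + s) * r) ∧
      |lineDeriv ℝ (fun y => lineDeriv ℝ K y e) w e| ≤ Lam / (r ^ ((n : ℝ) + s) * r ^ 2) := by
  have hw0 : 0 < ‖w‖ := hr.trans_le hw
  have h := hK.deriv_bound w e (norm_pos_iff.1 hw0) he
  have hp : 0 ≤ (n : ℝ) + s := by positivity
  have h0 : r ^ ((n : ℝ) + s) ≤ ‖w‖ ^ ((n : ℝ) + s) := Real.rpow_le_rpow hr.le hw hp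
  have hrp : (0 : ℝ) < r ^ ((n : ℝ) + s) := Real.rpow_pos_of_pos hr _
  have hb : Lam / ‖w‖ ^ ((n : ℝ) + s) ≤ Lam / r ^ ((n : ℝ) + s) := by gcongr
  have h1 := (le_max_left _ _).trans (h.trans hb)
  have h2 := (le_max_right _ _).trans (h.trans hb)
  constructor
  · rw [← div_div, le_div_iff₀ hr, mul_comm]
    exact (mul_le_mul_of_nonneg_right hw (abs_nonneg _)).trans h1
  · rw [← div_div, le_div_iff₀ (by positivity), mul_comm]
    exact (mul_le_mul_of_nonneg_right (by gcongr) (abs_nonneg _)).trans h2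

theorem half_norm_le {z e : Rn n} (he : ‖e‖ = 1) {σ : ℝ} (hσ : |σ| ≤ ‖z‖ / 2) :
    ‖z‖ / 2 ≤ ‖z + σ • e‖ := by
  have h1 : ‖z‖ ≤ ‖z + σ • e‖ + ‖σ • e‖ := by
    simpa using norm_sub_le (z + σ • e) (σ • e)
  rw [norm_smul, he, mul_one, Real.norm_eq_abs] at h1
  linarith

theorem abs_symmetric_differences_le (hK : KernelClassL2 s lam Lam K) (hs : 0 < s)
    (hLam : 0 ≤ Lam) {z e : Rn n} (hz : z ≠ 0) (he : ‖e‖ = 1) {τ : ℝ} (hτ : |τ| ≤ ‖z‖ / 2) :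
    |K (z + τ • e) - K (z - τ • e)| ≤
        2 * (Lam / ((‖z‖ / 2) ^ ((n : ℝ) + s) * (‖z‖ / 2))) * |τ| ∧
      |K (z + τ • e) + K (z - τ • e) - 2 * K z| ≤
        2 * (Lam / ((‖z‖ / 2) ^ ((n : ℝ) + s) * (‖z‖ / 2) ^ 2)) * τ ^ 2 := by
  have hr : 0 < ‖z‖ / 2 := half_pos (norm_pos_iff.2 hz)
  have hne : ∀ σ : ℝ, |σ| ≤ ‖z‖ / 2 → z + σ • e ≠ 0 := fun σ hσ =>
    norm_pos_iff.1 (hr.trans_le (half_norm_le he hσ))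
  have := NonlocalPerimeter.abs_symmetric_differences_le (f := fun σ => K (z + σ • e))
    (f' := fun σ => lineDeriv ℝ K (z + σ • e) e)
    (f'' := fun σ => lineDeriv ℝ (fun y => lineDeriv ℝ K y e) (z + σ • e) e)
    (fun σ hσ => hasDerivAt_of_lineDifferentiableAt (hK.lineDiff _ e (hne σ hσ) he))
    (fun σ hσ => hasDerivAt_of_lineDifferentiableAt (f := fun y => lineDeriv ℝ K y e)
      (hK.lineDiff₂ _ e (hne σ hσ) he))
    (fun σ hσ => (hK.abs_lineDeriv_le hs hLam he hr (half_norm_le he hσ)).1)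
    (fun σ hσ => (hK.abs_lineDeriv_le hs hLam he hr (half_norm_le he hσ)).2) hτ
  simpa [sub_eq_add_neg] using this

/-- The second order expansion of the kernel under a deformation in a fixed direction. -/
theorem deformation_le (hK : KernelClassL2 s lam Lam K) (hs : 0 < s) (hlam : 0 < lam)
    {z e : Rn n} (hz : z ≠ 0) (he : ‖e‖ = 1) {M t δ a b : ℝ}
    (hδ : |δ| ≤ M * ‖z‖) (ha : |a| ≤ M) (hb : |b| ≤ M) (ht : |t| * M ≤ 1 / 2) :
    K (z + (t * δ) • e) * ((1 + t * a) * (1 + t * b)) +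
        K (z - (t * δ) • e) * ((1 - t * a) * (1 - t * b)) ≤
      (2 + 2 ^ ((n : ℝ) + s + 6) * (Lam / lam) * M ^ 2 * t ^ 2) * K z := by
  have hLam := hK.Lam_nonneg_of_ne hlam hz
  have hr : 0 < ‖z‖ := norm_pos_iff.2 hz
  have hM : 0 ≤ M := (abs_nonneg _).trans ha
  have hτ : |t * δ| ≤ |t| * M * ‖z‖ := by
    rw [abs_mul, mul_assoc]; gcongr
  have hτ' : |t * δ| ≤ ‖z‖ / 2 := hτ.trans (by nlinarith)
  obtain ⟨h1, h2⟩ := hK.abs_symmetric_differences_le hs hLam hz he hτ'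
  set kp := K (z + (t * δ) • e)
  set km := K (z - (t * δ) • e)
  set k0 := K z
  set p : ℝ := (n : ℝ) + s with hp
  set Q : ℝ := Lam / ‖z‖ ^ p with hQ
  have hrp : 0 < ‖z‖ ^ p := Real.rpow_pos_of_pos hr _
  have hQ0 : 0 ≤ Q := by positivity
  have h2p : (0 : ℝ) < 2 ^ p := by positivity
  have h2p1 : (1 : ℝ) ≤ 2 ^ p := Real.one_le_rpow (by norm_num) (by positivity)
  have hdiv : (‖z‖ / 2) ^ p = ‖z‖ ^ p / 2 ^ p := Real.div_rpow hr.le (by norm_num) _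
  have e1 : Lam / ((‖z‖ / 2) ^ p * (‖z‖ / 2)) = 2 * 2 ^ p * Q / ‖z‖ := by
    rw [hdiv, hQ]; field_simp
  have e2 : Lam / ((‖z‖ / 2) ^ p * (‖z‖ / 2) ^ 2) = 4 * 2 ^ p * Q / ‖z‖ ^ 2 := by
    rw [hdiv, hQ]; field_simp; norm_num
  rw [e1] at h1
  rw [e2] at h2
  have hk0 : k0 ≤ Q := hK.upper z hz
  have hk0' : 0 ≤ k0 := (hK.pos hlam hz).le
  -- The lower bound on K makes all errors relative to K(z), so that after integration they are
  -- controlled by a perimeter.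
  have hQk : Q ≤ Lam / lam * k0 := by
    have := hK.lower z hz
    calc Q = Lam / lam * (lam / ‖z‖ ^ p) := by rw [hQ]; field_simp
      _ ≤ _ := by gcongr
  have hD : |kp - km| ≤ 4 * 2 ^ p * Q * (|t| * M) := by
    refine h1.trans ?_
    calc 2 * (2 * 2 ^ p * Q / ‖z‖) * |t * δ| ≤ 2 * (2 * 2 ^ p * Q / ‖z‖) * (|t| * M * ‖z‖) := by
          gcongr
      _ = _ := by field_simp; ring
  have hS : |kp + km - 2 * k0| ≤ 8 * 2 ^ p * Q * (t ^ 2 * M ^ 2) := by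
    refine h2.trans ?_
    have : (t * δ) ^ 2 ≤ (|t| * M * ‖z‖) ^ 2 := by
      rw [← sq_abs (t * δ)]; gcongr
    calc 2 * (4 * 2 ^ p * Q / ‖z‖ ^ 2) * (t * δ) ^ 2
        ≤ 2 * (4 * 2 ^ p * Q / ‖z‖ ^ 2) * (|t| * M * ‖z‖) ^ 2 := by gcongr
      _ = _ := by rw [mul_pow, mul_pow, sq_abs]; field_simp; ring
  have hab : |a * b| ≤ M ^ 2 := by
    rw [abs_mul, sq]; gcongr
  have habs : |a + b| ≤ 2 * M := (abs_add_le _ _).trans (by linarith)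
  have htM : t ^ 2 * M ^ 2 ≤ 1 := by
    rw [← sq_abs t, ← mul_pow]
    have : 0 ≤ |t| * M := by positivity
    nlinarith
  have htt : 0 ≤ t ^ 2 := sq_nonneg t
  have h1ab : |1 + t ^ 2 * (a * b)| ≤ 2 := by
    refine (abs_add_le _ _).trans ?_
    rw [abs_mul, abs_one, abs_of_nonneg htt]
    have := mul_le_mul_of_nonneg_left hab htt
    linarith
  have T1 : (kp + km - 2 * k0) * (1 + t ^ 2 * (a * b)) ≤ 8 * 2 ^ p * Q * (t ^ 2 * M ^ 2) * 2 := by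
    refine (le_abs_self _).trans ?_
    rw [abs_mul]; gcongr
  have T2 : (kp - km) * (t * (a + b)) ≤ 4 * 2 ^ p * Q * (|t| * M) * (|t| * (2 * M)) := by
    refine (le_abs_self _).trans ?_
    rw [abs_mul, abs_mul]; gcongr
  have T3 : 2 * k0 * (t ^ 2 * (a * b)) ≤ 2 * Q * (t ^ 2 * M ^ 2) := by
    have : t ^ 2 * (a * b) ≤ t ^ 2 * M ^ 2 := by
      have := (le_abs_self _).trans hab
      gcongr
    calc 2 * k0 * (t ^ 2 * (a * b)) ≤ 2 * k0 * (t ^ 2 * M ^ 2) := by gcongr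
      _ ≤ _ := by gcongr
  have T2' : 4 * 2 ^ p * Q * (|t| * M) * (|t| * (2 * M)) = 8 * 2 ^ p * Q * (t ^ 2 * M ^ 2) := by
    rw [← sq_abs t]; ring
  have hpow : (2 : ℝ) ^ (p + 6) = 64 * 2 ^ p := by
    rw [Real.rpow_add (by norm_num)]; norm_num; ring
  -- 26 = 16 + 8 + 2 collects `T1`, `T2` and `T3`; it is rounded up to 64 = 2 ^ 6.
  have hfin : 26 * 2 ^ p * Q * (t ^ 2 * M ^ 2) ≤
      64 * 2 ^ p * (Lam / lam * k0) * (t ^ 2 * M ^ 2) := by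
    have : 26 * 2 ^ p * Q ≤ 64 * 2 ^ p * (Lam / lam * k0) := by
      have h5 : 2 ^ p * Q ≤ 2 ^ p * (Lam / lam * k0) := by gcongr
      have h6 : 0 ≤ 2 ^ p * Q := by positivity
      linarith
    gcongr
  have h7 : Q * (t ^ 2 * M ^ 2) ≤ 2 ^ p * Q * (t ^ 2 * M ^ 2) := by
    have h6 : 0 ≤ Q * (t ^ 2 * M ^ 2) := by positivity
    rw [mul_assoc]
    exact le_mul_of_one_le_left h6 h2p1
  rw [hpow]
  -- The second difference of K meets the even part of the Jacobian product and the first difference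
  -- its odd part t(a + b), so everything beyond 2K(z) is of order t².
  have key : kp * ((1 + t * a) * (1 + t * b)) + km * ((1 - t * a) * (1 - t * b)) =
      2 * k0 + (kp + km - 2 * k0) * (1 + t ^ 2 * (a * b)) + 2 * k0 * (t ^ 2 * (a * b))
        + (kp - km) * (t * (a + b)) := by ring
  rw [key]
  linarith

/-- Only directional derivatives are assumed, but their bound is uniform in the direction. The mean
value inequality on the segment from z to w therefore gives a local Lipschitz estimate. -/
theorem continuousAt (hK : KernelClassL2 s lam Lam K) (hs : 0 < s) (hlam : 0 < lam)
    {z : Rn n} (hz : z ≠ 0) : ContinuousAt K z := by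
  have hLam := hK.Lam_nonneg_of_ne hlam hz
  have hr : 0 < ‖z‖ / 2 := half_pos (norm_pos_iff.2 hz)
  set D := Lam / ((‖z‖ / 2) ^ ((n : ℝ) + s) * (‖z‖ / 2)) with hD
  refine continuousAt_of_locally_lipschitz hr D fun w hw => ?_
  rcases eq_or_ne w z with rfl | hwz
  · simp
  have hd : 0 < ‖w - z‖ := norm_pos_iff.2 (sub_ne_zero.2 hwz)
  set e : Rn n := ‖w - z‖⁻¹ • (w - z) with he
  have he1 : ‖e‖ = 1 := by
    rw [he, norm_smul, norm_inv, norm_norm, inv_mul_cancel₀ hd.ne']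
  have hmem : ∀ σ ∈ Icc (0 : ℝ) ‖w - z‖, |σ| ≤ ‖z‖ / 2 := fun σ hσ => by
    rw [abs_of_nonneg hσ.1]
    rw [dist_eq_norm] at hw
    exact hσ.2.trans hw.le
  have hne : ∀ σ ∈ Icc (0 : ℝ) ‖w - z‖, z + σ • e ≠ 0 := fun σ hσ =>
    norm_pos_iff.1 (hr.trans_le (half_norm_le he1 (hmem σ hσ)))
  have := (convex_Icc (0 : ℝ) ‖w - z‖).norm_image_sub_le_of_norm_hasDerivWithin_le
    (f := fun σ => K (z + σ • e)) (f' := fun σ => lineDeriv ℝ K (z + σ • e) e) (C := D)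
    (fun σ hσ => (hasDerivAt_of_lineDifferentiableAt
      (hK.lineDiff _ e (hne σ hσ) he1)).hasDerivWithinAt)
    (fun σ hσ => (hK.abs_lineDeriv_le hs hLam he1 hr (half_norm_le he1 (hmem σ hσ))).1)
    (left_mem_Icc.2 hd.le) (right_mem_Icc.2 hd.le)
  have e1 : z + ‖w - z‖ • e = w := by
    rw [he, smul_smul, mul_inv_cancel₀ hd.ne']; simp
  simp only [e1, zero_smul, add_zero, sub_zero, norm_norm] at this
  rwa [dist_eq_norm, dist_eq_norm]

/-- K is continuous away from 0, and the unconstrained value at 0 adds at most one point to a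
preimage. -/
theorem measurable (hK : KernelClassL2 s lam Lam K) (hs : 0 < s) (hlam : 0 < lam) :
    Measurable K := by
  refine measurable_of_isOpen fun U hU => ?_
  have h1 : IsOpen (K ⁻¹' U ∩ {0}ᶜ) := by
    rw [inter_comm]
    exact (continuousOn_of_forall_continuousAt fun z hz => hK.continuousAt hs hlam hz).isOpen_inter_preimage
      isOpen_compl_singleton hU
  rw [← inter_union_sdiff (K ⁻¹' U) {0}ᶜ]
  refine h1.measurableSet.union (Set.Subsingleton.measurableSet ?_)
  rw [sdiff_compl]
  exact subsingleton_singleton.anti inter_subset_right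

end KernelClassL2

/-! ### Deformations in a fixed direction as integral flows -/

/-- A 1/2-Lipschitz perturbation of the identity is bijective, its derivative is invertible by the
Neumann series, and the inverse function theorem makes the inverse C². -/
theorem exists_contDiff_homeomorph_id_add {V : Type*} [NormedAddCommGroup V] [NormedSpace ℝ V]
    [CompleteSpace V] [Nontrivial V] {w : V → V} (hw : ContDiff ℝ 2 w)
    (hL : LipschitzWith (1 / 2) w) :
    ∃ G : V ≃ₜ V, (∀ x, G x = x + w x) ∧ ContDiff ℝ 2 (G.symm : V → V) := by
  have happ : ApproximatesLinearOn (fun x => x + w x)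
      ((ContinuousLinearEquiv.refl ℝ V : V ≃L[ℝ] V) : V →L[ℝ] V) univ (1 / 2) := by
    intro x _ y _
    have h := hL.norm_sub_le x y
    have e1 : x + w x - (y + w y) - (x - y) = w x - w y := by abel
    change ‖x + w x - (y + w y) - (x - y)‖ ≤ _
    rwa [e1]
  have hN : (1 / 2 : ℝ≥0) <
      ‖((ContinuousLinearEquiv.refl ℝ V).symm : V →L[ℝ] V)‖₊⁻¹ := by
    have : ‖((ContinuousLinearEquiv.refl ℝ V).symm : V →L[ℝ] V)‖₊ = 1 := by
      rw [← NNReal.coe_inj]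
      exact ContinuousLinearMap.norm_id
    rw [this, inv_one]
    exact one_half_lt_one
  let G : V ≃ₜ V := happ.toHomeomorph (fun x => x + w x) (Or.inr hN)
  have hG : ∀ x, G x = x + w x := fun x => rfl
  refine ⟨G, hG, ?_⟩
  have hA : ∀ a, ‖-fderiv ℝ w a‖ < 1 := fun a => by
    rw [norm_neg]
    refine (norm_fderiv_le_of_lipschitz ℝ hL).trans_lt ?_
    norm_num
  have hGd : ∀ a, HasFDerivAt G
      ((ContinuousLinearEquiv.ofUnit (Units.oneSub (-fderiv ℝ w a) (hA a)) : V ≃L[ℝ] V) :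
        V →L[ℝ] V) a := by
    intro a
    have h1 : HasFDerivAt (fun x => x + w x) (ContinuousLinearMap.id ℝ V + fderiv ℝ w a) a :=
      (hasFDerivAt_id a).add (hw.differentiable (by norm_num) a).hasFDerivAt
    refine (show HasFDerivAt G _ a from h1).congr_fderiv ?_
    ext v
    symm
    change (Units.oneSub (-fderiv ℝ w a) (hA a) : V →L[ℝ] V) v = _
    simp
  exact G.contDiff_symm hGd (contDiff_id.add hw)

/-- The flow of the autonomous field η e is not affine in t. A time-dependent field is used instead,
for which each particle keeps the velocity η(x) of its starting point for short times. -/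
theorem exists_admissible_flow {n : ℕ} {η : Rn n → ℝ} (hη : ContDiff ℝ 2 η) {R : ℝ} (hR : R < 4)
    (hsupp : ∀ x, R < ‖x‖ → η x = 0) (e : Rn n) :
    ∃ c : ℝ, 0 < c ∧ ∃ t₁ : ℝ, 0 < t₁ ∧ ∃ X Ψ, IsAdmissibleField (Metric.ball (0 : Rn n) 4) X ∧
      IsIntegralFlow X Ψ ∧ ∀ t, |t| < t₁ → ∀ x, Ψ t x = x + ((c * t) * η x) • e := by
  -- θ(t) = t for |t| ≤ 1/4 and θ vanishes for |t| ≥ 1/2, which keeps the field compactly supported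
  -- in time.
  let b : ContDiffBump (0 : ℝ) := ⟨1 / 4, 1 / 2, by norm_num, by norm_num⟩
  let θ : ℝ → ℝ := fun t => t * b t
  have hθ : ContDiff ℝ 3 θ := contDiff_id.mul b.contDiff
  have hθ' : ContDiff ℝ 2 (deriv θ) := by
    have : ContDiff ℝ (2 + 1) θ := by
      convert hθ using 1; norm_num
    exact (contDiff_succ_iff_deriv.1 this).2.2
  have hθ0 : ∀ t, 1 / 2 < |t| → θ t = 0 := fun t ht => by
    have : b t = 0 := b.zero_of_le_dist (by rw [Real.dist_0_eq_abs]; exact ht.le)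
    simp [θ, this]
  have hθsupp : tsupport θ ⊆ Icc (-(1 / 2)) (1 / 2) := by
    refine closure_minimal (fun t ht => ?_) isClosed_Icc
    by_contra h
    refine ht (hθ0 t ?_)
    by_contra h'
    exact h (abs_le.1 (not_lt.1 h'))
  let B : Set (Rn n × ℝ) := Metric.closedBall 0 R ×ˢ Icc (-(1 / 2)) (1 / 2)
  have hB : IsCompact B := (isCompact_closedBall _ _).prod isCompact_Icc
  let g : Rn n × ℝ → Rn n := fun p => (θ p.2 * η p.1) • e
  have hg : ContDiff ℝ 2 g := by
    have h1 : ContDiff ℝ 2 fun p : Rn n × ℝ => θ p.2 := (hθ.of_le (by norm_num)).comp contDiff_snd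
    have h2 : ContDiff ℝ 2 fun p : Rn n × ℝ => η p.1 := hη.comp contDiff_fst
    exact (h1.mul h2).smul contDiff_const
  have hgc : HasCompactSupport g := by
    refine HasCompactSupport.intro hB fun p hp => ?_
    by_cases h : ‖p.1‖ ≤ R
    · have : θ p.2 = 0 := by
        refine hθ0 _ ?_
        by_contra h'
        exact hp ⟨mem_closedBall_zero_iff.2 h, abs_le.1 (not_lt.1 h')⟩
      simp [g, this]
    · simp [g, hsupp p.1 (not_le.1 h)]
  obtain ⟨L, hL⟩ := hg.lipschitzWith_of_hasCompactSupport hgc (by norm_num)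
  -- Slowing the motion by c makes the space-time displacement 1/2-Lipschitz; the time change is
  -- undone in `IsStableSet.shear`.
  let c : ℝ := 1 / (2 * (L + 1))
  have hc : 0 < c := by positivity
  let w : Rn n × ℝ → Rn n × ℝ := fun p => (c • g p, 0)
  have hw : ContDiff ℝ 2 w := (hg.const_smul c).prodMk contDiff_const
  have hwL : LipschitzWith (1 / 2) w := by
    refine LipschitzWith.of_dist_le_mul fun p q => ?_
    have h1 : dist (w p) (w q) = c * dist (g p) (g q) := by
      rw [Prod.dist_eq]
      simp only [w, dist_self, dist_smul₀, Real.norm_of_nonneg hc.le]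
      exact max_eq_left (by positivity)
    rw [h1]
    have h2 := hL.dist_le_mul p q
    have h3 : c * L ≤ 1 / 2 := by
      simp only [c]
      rw [div_mul_eq_mul_div, one_mul, div_le_iff₀ (by positivity)]
      linarith
    calc c * dist (g p) (g q) ≤ c * (L * dist p q) := by gcongr
      _ = c * L * dist p q := by ring
      _ ≤ 1 / 2 * dist p q := by gcongr
      _ = _ := by norm_num
  obtain ⟨G, hG, hGs⟩ := exists_contDiff_homeomorph_id_add hw hwL
  have hG2 : ∀ p, (G p).2 = p.2 := fun p => by simp [hG, w]
  have hGs2 : ∀ q, (G.symm q).2 = q.2 := fun q => by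
    rw [← hG2 (G.symm q), G.apply_symm_apply]
  -- The velocity must be a function of the current position, so the starting point is recovered
  -- through the inverse of G.
  let X : Rn n × ℝ → Rn n := fun q => (c * (deriv θ q.2 * η (G.symm q).1)) • e
  let Ψ : ℝ → Rn n → Rn n := fun t x => x + (c * (θ t * η x)) • e
  have hΨG : ∀ t x, (Ψ t x, t) = G (x, t) := fun t x => by
    simp [hG, w, Ψ, g, smul_smul]
  have hXsupp : Function.support X ⊆ B := by
    intro q hq
    have hq' : X q ≠ 0 := hq
    have h1 : deriv θ q.2 ≠ 0 := fun h => hq' (by simp [X, h])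
    have h2 : η (G.symm q).1 ≠ 0 := fun h => hq' (by simp [X, h])
    refine ⟨?_, hθsupp (support_deriv_subset h1)⟩
    rw [mem_closedBall_zero_iff]
    by_contra h
    have h3 : η q.1 = 0 := hsupp _ (not_le.1 h)
    have h4 : G q = q := by
      rw [hG]
      simp [w, g, h3]
    have h5 : G.symm q = q := by
      rw [Homeomorph.symm_apply_eq, h4]
    rw [h5] at h2
    exact h2 h3
  have hXt : tsupport X ⊆ B := closure_minimal hXsupp hB.isClosed
  refine ⟨c, hc, 1 / 4, by norm_num, X, Ψ, ⟨?_, ?_, ?_⟩, ⟨?_, ?_⟩, ?_⟩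
  · have h1 : ContDiff ℝ 2 fun q : Rn n × ℝ => deriv θ q.2 := hθ'.comp contDiff_snd
    have h2 : ContDiff ℝ 2 fun q : Rn n × ℝ => η (G.symm q).1 := hη.comp (contDiff_fst.comp hGs)
    exact (contDiff_const.mul (h1.mul h2)).smul contDiff_const
  · exact hB.of_isClosed_subset (isClosed_tsupport _) hXt
  · refine hXt.trans (prod_mono (Metric.closedBall_subset_ball hR) ?_)
    intro t ht
    exact ⟨by linarith [ht.1], by linarith [ht.2]⟩
  · intro x; simp [Ψ, θ]
  · intro x t _
    have h1 : X (Ψ t x, t) = (c * (deriv θ t * η x)) • e := by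
      rw [hΨG]
      simp only [X, G.symm_apply_apply, hG2]
    rw [h1]
    have h2 : HasDerivAt θ (deriv θ t) t := (hθ.differentiable (by norm_num) t).hasDerivAt
    exact (((h2.mul_const (η x)).const_mul c).smul_const e).const_add x
  · intro t ht x
    have : b t = 1 := b.one_of_mem_closedBall (by
      rw [mem_closedBall_zero_iff]; exact ht.le)
    simp [Ψ, θ, this, mul_assoc]

/-- The set deformed by `x ↦ x + t η(x) e`. -/
noncomputable def shear {n : ℕ} (η : Rn n → ℝ) (e : Rn n) (t : ℝ) (x : Rn n) : Rn n :=
  x + (t * η x) • e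

theorem IsStableSet.shear {n : ℕ} {K : Rn n → ℝ} {E : Set (Rn n)}
    (hE : IsStableSet K (Metric.ball 0 4) E) {η : Rn n → ℝ} (hη : ContDiff ℝ 2 η) {R : ℝ}
    (hR : R < 4) (hsupp : ∀ x, R < ‖x‖ → η x = 0) (e : Rn n) {ε : ℝ} (hε : 0 < ε) :
    ∃ t₀ : ℝ, 0 < t₀ ∧ ∀ t, |t| < t₀ →
      kPerimeter K (Metric.ball 0 4) E ≤
        kPerimeter K (Metric.ball 0 4) (shear η e t '' E ∪ E) + ENNReal.ofReal (ε * t ^ 2) ∧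
      kPerimeter K (Metric.ball 0 4) E ≤
        kPerimeter K (Metric.ball 0 4) (shear η e t '' E ∩ E) + ENNReal.ofReal (ε * t ^ 2) := by
  obtain ⟨c, hc, t₁, ht₁, X, Ψ, hX, hΨ, hΨt⟩ := exists_admissible_flow hη hR hsupp e
  -- The flow at time t / c is the shear at time t, and the factor c² absorbs this change of time in
  -- the quadratic error.
  obtain ⟨t₀, ht₀, h⟩ := hE.2 X hX Ψ hΨ (ε * c ^ 2) (by positivity)
  refine ⟨c * min t₀ t₁, by positivity, fun t ht => ?_⟩
  have h1 : |t / c| < min t₀ t₁ := by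
    rw [abs_div, abs_of_pos hc, div_lt_iff₀ hc]; linarith
  have h2 : Ψ (t / c) = NonlocalPerimeter.shear η e t := by
    funext x
    rw [hΨt _ (h1.trans_le (min_le_right _ _)), mul_div_cancel₀ _ hc.ne', NonlocalPerimeter.shear]
  have h3 : ε * c ^ 2 * (t / c) ^ 2 = ε * t ^ 2 := by
    field_simp
  have := h (t / c) (abs_lt.1 (h1.trans_le (min_le_left _ _)))
  rwa [h2, h3] at this

/-! ### The nonlocal perimeter as an integral over pairs -/

/-- Pairs separated by `E`, at least one member of which lies in `Ω`. -/
def crossing {n : ℕ} (Ω E : Set (Rn n)) : Set (Rn n × Rn n) :=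
  (E ×ˢ Eᶜ) ∩ {p | p.1 ∈ Ω ∨ p.2 ∈ Ω}

theorem measurableSet_prod_or {n : ℕ} {Ω : Set (Rn n)} (hΩ : MeasurableSet Ω) :
    MeasurableSet {p : Rn n × Rn n | p.1 ∈ Ω ∨ p.2 ∈ Ω} :=
  (measurable_fst hΩ).union (measurable_snd hΩ)

theorem measurableSet_crossing {n : ℕ} {Ω E : Set (Rn n)} (hΩ : MeasurableSet Ω)
    (hE : MeasurableSet E) : MeasurableSet (crossing Ω E) :=
  (hE.prod hE.compl).inter (measurableSet_prod_or hΩ)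

theorem lintegral_lintegral_eq_setLIntegral_prod {n : ℕ} {A B : Set (Rn n)}
    {f : Rn n × Rn n → ℝ≥0∞} (hf : Measurable f) :
    ∫⁻ x in A, ∫⁻ y in B, f (x, y) = ∫⁻ p in A ×ˢ B, f p := by
  rw [Measure.volume_eq_prod, ← Measure.prod_restrict, lintegral_prod _ hf.aemeasurable]

/-- The three products partition the crossing set. The integrand is general because both K(x - y)
and the pulled-back kernel `shearKernel` are needed. -/
theorem setLIntegral_crossing {n : ℕ} {Ω E : Set (Rn n)} (hΩ : MeasurableSet Ω)
    (hE : MeasurableSet E) {f : Rn n × Rn n → ℝ≥0∞} (hf : Measurable f) :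
    (∫⁻ x in E ∩ Ω, ∫⁻ y in Eᶜ ∩ Ω, f (x, y)) + (∫⁻ x in E ∩ Ω, ∫⁻ y in Eᶜ \ Ω, f (x, y))
      + (∫⁻ x in E \ Ω, ∫⁻ y in Eᶜ ∩ Ω, f (x, y)) = ∫⁻ p in crossing Ω E, f p := by
  simp only [lintegral_lintegral_eq_setLIntegral_prod hf]
  have m2 : MeasurableSet ((E ∩ Ω) ×ˢ (Eᶜ \ Ω)) := (hE.inter hΩ).prod (hE.compl.diff hΩ)
  have m3 : MeasurableSet ((E \ Ω) ×ˢ (Eᶜ ∩ Ω)) := (hE.diff hΩ).prod (hE.compl.inter hΩ)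
  rw [← lintegral_union m2, ← lintegral_union m3]
  · congr 2
    ext ⟨x, y⟩
    simp only [crossing, mem_union, mem_prod, mem_inter_iff, mem_sdiff, mem_compl_iff, mem_ofPred_eq]
    tauto
  · rw [disjoint_left]
    rintro ⟨x, y⟩ h h'
    simp only [mem_union, mem_prod, mem_inter_iff, mem_sdiff, mem_compl_iff] at h h'
    tauto
  · rw [disjoint_left]
    rintro ⟨x, y⟩ h h'
    simp only [mem_prod, mem_inter_iff, mem_sdiff, mem_compl_iff] at h h'
    tauto

theorem measurable_kernel_sub {n : ℕ} {K : Rn n → ℝ} (hK : Measurable K) :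
    Measurable fun p : Rn n × Rn n => ENNReal.ofReal (K (p.1 - p.2)) :=
  (hK.comp (measurable_fst.sub measurable_snd)).ennreal_ofReal

theorem kPerimeter_eq_setLIntegral {n : ℕ} {K : Rn n → ℝ} (hK : Measurable K) {Ω E : Set (Rn n)}
    (hΩ : MeasurableSet Ω) (hE : MeasurableSet E) :
    kPerimeter K Ω E = ∫⁻ p in crossing Ω E, ENNReal.ofReal (K (p.1 - p.2)) :=
  setLIntegral_crossing hΩ hE (measurable_kernel_sub hK)

/-! ### The perimeter of a sheared set -/

section Shear

variable {n : ℕ} {η : Rn n → ℝ} {e : Rn n} {M : ℝ≥0} {t : ℝ}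

theorem shear_sub_shear (x y : Rn n) :
    shear η e t x - shear η e t y = (x - y) + (t * (η x - η y)) • e := by
  simp only [shear]; module

theorem norm_sub_le_two_mul_shear (hM : LipschitzWith M η) (he : ‖e‖ = 1)
    (ht : |t| * M ≤ 1 / 2) (x y : Rn n) :
    ‖x - y‖ / 2 ≤ ‖shear η e t x - shear η e t y‖ := by
  rw [shear_sub_shear]
  refine KernelClassL2.half_norm_le he ?_
  have h := hM.dist_le_mul x y
  rw [Real.dist_eq, dist_eq_norm] at h
  rw [abs_mul]
  calc |t| * |η x - η y| ≤ |t| * (M * ‖x - y‖) := by gcongr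
    _ = |t| * M * ‖x - y‖ := by ring
    _ ≤ 1 / 2 * ‖x - y‖ := by gcongr
    _ = _ := by ring

theorem shear_injective (hM : LipschitzWith M η) (he : ‖e‖ = 1)
    (ht : |t| * M ≤ 1 / 2) : Function.Injective (shear η e t) := by
  intro x y hxy
  have := norm_sub_le_two_mul_shear hM he ht x y
  rw [hxy, sub_self, norm_zero] at this
  have h0 : ‖x - y‖ = 0 := le_antisymm (by linarith) (norm_nonneg _)
  exact sub_eq_zero.1 (norm_eq_zero.1 h0)

/-- Surjectivity is needed so that taking images commutes with complements in the perimeter of the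
sheared set. -/
theorem shear_bijective (hη : ContDiff ℝ 2 η) (hM : LipschitzWith M η) (he : ‖e‖ = 1)
    (ht : |t| * M ≤ 1 / 2) : Function.Bijective (shear η e t) := by
  have : Nontrivial (Rn n) := ⟨e, 0, norm_pos_iff.1 (by rw [he]; exact one_pos)⟩
  have hw : ContDiff ℝ 2 fun x => (t * η x) • e := (contDiff_const.mul hη).smul contDiff_const
  have hL : LipschitzWith (1 / 2) fun x => (t * η x) • e := by
    refine LipschitzWith.of_dist_le_mul fun x y => ?_
    have h := hM.dist_le_mul x y
    rw [Real.dist_eq] at h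
    rw [dist_eq_norm, ← sub_smul, norm_smul, he, mul_one, ← mul_sub, norm_mul, Real.norm_eq_abs,
      Real.norm_eq_abs]
    calc |t| * |η x - η y| ≤ |t| * (M * dist x y) := by gcongr
      _ = |t| * M * dist x y := by ring
      _ ≤ 1 / 2 * dist x y := by gcongr
      _ = _ := by norm_num
  obtain ⟨G, hG, -⟩ := exists_contDiff_homeomorph_id_add hw hL
  have : (G : Rn n → Rn n) = shear η e t := funext hG
  exact this ▸ G.bijective

/-- The Jacobian determinant of `shear η e t`. -/
noncomputable def shearJacobian (η : Rn n → ℝ) (e : Rn n) (t : ℝ) (x : Rn n) : ℝ :=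
  1 + t * fderiv ℝ η x e

theorem hasFDerivAt_shear (hη : ContDiff ℝ 2 η) (x : Rn n) :
    HasFDerivAt (shear η e t)
      (ContinuousLinearMap.id ℝ (Rn n) + (t • fderiv ℝ η x).smulRight e) x := by
  have h1 := (hη.differentiable (by norm_num) x).hasFDerivAt
  exact (hasFDerivAt_id x).add ((h1.const_mul t).smul_const e)

/-- The derivative is the identity plus a rank-one map, so its determinant is exactly affine in t.
-/
theorem det_shear_deriv (x : Rn n) :
    (ContinuousLinearMap.id ℝ (Rn n) + (t • fderiv ℝ η x).smulRight e).det =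
      shearJacobian η e t x := by
  have h : ((ContinuousLinearMap.id ℝ (Rn n) + (t • fderiv ℝ η x).smulRight e :
      Rn n →L[ℝ] Rn n) : Rn n →ₗ[ℝ] Rn n) =
      LinearMap.transvection ((t • fderiv ℝ η x : Rn n →L[ℝ] ℝ) : Rn n →ₗ[ℝ] ℝ) e := by
    ext v; rfl
  rw [ContinuousLinearMap.det, h, LinearMap.transvection.det]
  rfl

theorem abs_fderiv_apply_le (hM : LipschitzWith M η) (he : ‖e‖ = 1) (x : Rn n) :
    |fderiv ℝ η x e| ≤ M := by
  have h1 := (fderiv ℝ η x).le_opNorm e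
  rw [he, mul_one] at h1
  exact h1.trans (norm_fderiv_le_of_lipschitz ℝ hM)

theorem shearJacobian_nonneg (hM : LipschitzWith M η) (he : ‖e‖ = 1)
    (ht : |t| * M ≤ 1 / 2) (x : Rn n) : 0 ≤ shearJacobian η e t x := by
  have h : |t * fderiv ℝ η x e| ≤ 1 / 2 := by
    rw [abs_mul]
    exact (mul_le_mul_of_nonneg_left (abs_fderiv_apply_le hM he x) (abs_nonneg t)).trans ht
  have := (abs_le.1 h).1
  unfold shearJacobian
  linarith

theorem continuous_shearJacobian (hη : ContDiff ℝ 2 η) : Continuous (shearJacobian η e t) := by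
  have : Continuous fun x => fderiv ℝ η x e :=
    (hη.continuous_fderiv (by norm_num)).clm_apply continuous_const
  exact continuous_const.add (continuous_const.mul this)

theorem continuous_shear (hη : ContDiff ℝ 2 η) : Continuous (shear η e t) :=
  continuous_id.add ((continuous_const.mul hη.continuous).smul continuous_const)

/-- The kernel pulled back by a shear. -/
noncomputable def shearKernel (K : Rn n → ℝ) (η : Rn n → ℝ) (e : Rn n) (t : ℝ)
    (p : Rn n × Rn n) : ℝ≥0∞ :=
  ENNReal.ofReal (shearJacobian η e t p.1) * (ENNReal.ofReal (shearJacobian η e t p.2) *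
    ENNReal.ofReal (K (shear η e t p.1 - shear η e t p.2)))

theorem measurable_shearKernel {K : Rn n → ℝ} (hK : Measurable K) (hη : ContDiff ℝ 2 η) :
    Measurable (shearKernel K η e t) := by
  have hJ := (continuous_shearJacobian (e := e) (t := t) hη).measurable
  have hS := (continuous_shear (e := e) (t := t) hη).measurable
  exact (hJ.comp measurable_fst).ennreal_ofReal.mul
    ((hJ.comp measurable_snd).ennreal_ofReal.mul
      (hK.comp ((hS.comp measurable_fst).sub (hS.comp measurable_snd))).ennreal_ofReal)

theorem interaction_shear {K : Rn n → ℝ} (hη : ContDiff ℝ 2 η) (hM : LipschitzWith M η)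
    (he : ‖e‖ = 1) (ht : |t| * M ≤ 1 / 2) {A B : Set (Rn n)} (hA : MeasurableSet A)
    (hB : MeasurableSet B) :
    interaction K (shear η e t '' A) (shear η e t '' B) =
      ∫⁻ x in A, ∫⁻ y in B, shearKernel K η e t (x, y) := by
  have hinj := shear_injective hM he ht
  unfold interaction
  rw [lintegral_image_eq_lintegral_abs_det_fderiv_mul volume hA
    (fun x _ => (hasFDerivAt_shear hη x).hasFDerivWithinAt) hinj.injOn]
  refine lintegral_congr fun x => ?_
  rw [lintegral_image_eq_lintegral_abs_det_fderiv_mul volume hB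
    (fun x _ => (hasFDerivAt_shear hη x).hasFDerivWithinAt) hinj.injOn,
    ← lintegral_const_mul' _ _ ENNReal.ofReal_ne_top]
  refine lintegral_congr fun y => ?_
  rw [det_shear_deriv, det_shear_deriv, abs_of_nonneg (shearJacobian_nonneg hM he ht x),
    abs_of_nonneg (shearJacobian_nonneg hM he ht y)]
  rfl

theorem shear_of_eq_zero {x : Rn n} (h : η x = 0) : shear η e t x = x := by
  simp [shear, h]

/-- Points outside the ball are fixed, so by injectivity no point inside can be carried out. -/
theorem shear_mem_ball_iff (hM : LipschitzWith M η) (he : ‖e‖ = 1) (ht : |t| * M ≤ 1 / 2)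
    {r : ℝ} (hsupp : ∀ x, r ≤ ‖x‖ → η x = 0) (x : Rn n) :
    shear η e t x ∈ Metric.ball (0 : Rn n) r ↔ x ∈ Metric.ball (0 : Rn n) r := by
  simp only [mem_ball_zero_iff, ← not_le, not_iff_not]
  constructor
  · intro h
    have h1 := shear_of_eq_zero (e := e) (t := t) (hsupp _ h)
    rwa [shear_injective hM he ht h1] at h
  · intro h
    rwa [shear_of_eq_zero (hsupp _ h)]

theorem shear_image_inter_ball (hM : LipschitzWith M η) (he : ‖e‖ = 1) (ht : |t| * M ≤ 1 / 2)
    {r : ℝ} (hsupp : ∀ x, r ≤ ‖x‖ → η x = 0) (A : Set (Rn n)) :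
    shear η e t '' (A ∩ Metric.ball 0 r) = shear η e t '' A ∩ Metric.ball 0 r ∧
      shear η e t '' (A \ Metric.ball 0 r) = shear η e t '' A \ Metric.ball 0 r := by
  have h := shear_mem_ball_iff hM he ht hsupp
  constructor
  · ext y; constructor
    · rintro ⟨x, ⟨hx, hx'⟩, rfl⟩
      exact ⟨⟨x, hx, rfl⟩, (h x).2 hx'⟩
    · rintro ⟨⟨x, hx, rfl⟩, hx'⟩
      exact ⟨x, ⟨hx, (h x).1 hx'⟩, rfl⟩
  · ext y; constructor
    · rintro ⟨x, ⟨hx, hx'⟩, rfl⟩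
      exact ⟨⟨x, hx, rfl⟩, fun h' => hx' ((h x).1 h')⟩
    · rintro ⟨⟨x, hx, rfl⟩, hx'⟩
      exact ⟨x, ⟨hx, fun h' => hx' ((h x).2 h')⟩, rfl⟩

theorem kPerimeter_shear {K : Rn n → ℝ} (hK : Measurable K) (hη : ContDiff ℝ 2 η)
    (hM : LipschitzWith M η) (he : ‖e‖ = 1) (ht : |t| * M ≤ 1 / 2) {r : ℝ}
    (hsupp : ∀ x, r ≤ ‖x‖ → η x = 0) {E : Set (Rn n)} (hE : MeasurableSet E) :
    kPerimeter K (Metric.ball 0 r) (shear η e t '' E) =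
      ∫⁻ p in crossing (Metric.ball 0 r) E, shearKernel K η e t p := by
  have hb : MeasurableSet (Metric.ball (0 : Rn n) r) := Metric.isOpen_ball.measurableSet
  have hi := shear_image_inter_ball hM he ht hsupp
  rw [kPerimeter, ← image_compl_eq (shear_bijective hη hM he ht), ← (hi E).1, ← (hi E).2,
    ← (hi Eᶜ).1, ← (hi Eᶜ).2,
    interaction_shear hη hM he ht (hE.inter hb) (hE.compl.inter hb),
    interaction_shear hη hM he ht (hE.inter hb) (hE.compl.diff hb),
    interaction_shear hη hM he ht (hE.diff hb) (hE.compl.inter hb),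
    setLIntegral_crossing hb hE (measurable_shearKernel hK hη)]

/-- The constant in the second variation estimate. -/
noncomputable def variationConst (n : ℕ) (s lam Lam : ℝ) : ℝ :=
  2 ^ ((n : ℝ) + s + 6) * (Lam / lam)

theorem shearKernel_add_le {K : Rn n → ℝ} {s lam Lam : ℝ} (hK : KernelClassL2 s lam Lam K)
    (hs : 0 < s) (hlam : 0 < lam) (hM : LipschitzWith M η)
    (he : ‖e‖ = 1) (ht : |t| * M ≤ 1 / 2) {x y : Rn n} (hxy : x ≠ y) :
    shearKernel K η e t (x, y) + shearKernel K η e (-t) (x, y) ≤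
      (2 + ENNReal.ofReal (variationConst n s lam Lam * M ^ 2 * t ^ 2)) *
        ENNReal.ofReal (K (x - y)) := by
  have ht' : |-t| * M ≤ 1 / 2 := by rwa [abs_neg]
  have hz : x - y ≠ 0 := sub_ne_zero.2 hxy
  have hLam := hK.Lam_nonneg_of_ne hlam hz
  have key := hK.deformation_le hs hlam hz he (M := M) (t := t) (δ := η x - η y)
    (a := fderiv ℝ η x e) (b := fderiv ℝ η y e)
    (by simpa [Real.dist_eq, dist_eq_norm] using hM.dist_le_mul x y)
    (abs_fderiv_apply_le hM he x) (abs_fderiv_apply_le hM he y) ht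
  have hC : 0 ≤ variationConst n s lam Lam * M ^ 2 * t ^ 2 := by
    unfold variationConst; positivity
  have hKt : ∀ σ : ℝ, |σ| * M ≤ 1 / 2 → 0 ≤ K (shear η e σ x - shear η e σ y) := fun σ hσ =>
    (hK.pos hlam (sub_ne_zero.2 fun h => hxy (shear_injective hM he hσ h))).le
  have h1 : ∀ σ : ℝ, |σ| * M ≤ 1 / 2 → shearKernel K η e σ (x, y) =
      ENNReal.ofReal (K (shear η e σ x - shear η e σ y) *
        ((1 + σ * fderiv ℝ η x e) * (1 + σ * fderiv ℝ η y e))) := by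
    intro σ hσ
    have hx := shearJacobian_nonneg hM he hσ x
    have hy := shearJacobian_nonneg hM he hσ y
    change shearKernel K η e σ (x, y) = ENNReal.ofReal (K (shear η e σ x - shear η e σ y) *
      (shearJacobian η e σ x * shearJacobian η e σ y))
    rw [mul_comm (K _), ENNReal.ofReal_mul (mul_nonneg hx hy), ENNReal.ofReal_mul hx, mul_assoc]
    rfl
  have h2 : ∀ σ : ℝ, |σ| * M ≤ 1 / 2 → 0 ≤ K (shear η e σ x - shear η e σ y) *
        ((1 + σ * fderiv ℝ η x e) * (1 + σ * fderiv ℝ η y e)) := fun σ hσ =>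
    mul_nonneg (hKt σ hσ) (mul_nonneg (shearJacobian_nonneg hM he hσ x)
      (shearJacobian_nonneg hM he hσ y))
  have h3 : (2 : ℝ≥0∞) + ENNReal.ofReal (variationConst n s lam Lam * M ^ 2 * t ^ 2) =
      ENNReal.ofReal (2 + variationConst n s lam Lam * M ^ 2 * t ^ 2) := by
    rw [ENNReal.ofReal_add (by norm_num) hC]; norm_num
  rw [h1 t ht, h1 (-t) ht', ← ENNReal.ofReal_add (h2 t ht) (h2 (-t) ht'), h3,
    ← ENNReal.ofReal_mul (by positivity)]
  refine ENNReal.ofReal_le_ofReal ?_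
  rw [shear_sub_shear, shear_sub_shear]
  have e1 : (x - y) + (-t * (η x - η y)) • e = (x - y) - (t * (η x - η y)) • e := by module
  rw [e1]
  simpa only [neg_mul, ← sub_eq_add_neg, variationConst] using key

/-- A pair with both points outside B_r is unmoved, with Jacobians 1, and contributes no error.
Hence the error sees only the perimeter in the smaller ball, a localisation essential for the final
absorption. -/
theorem kPerimeter_shear_add_le {K : Rn n → ℝ} {s lam Lam : ℝ} (hK : KernelClassL2 s lam Lam K)
    (hs : 0 < s) (hlam : 0 < lam) (hη : ContDiff ℝ 2 η) (hM : LipschitzWith M η)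
    (he : ‖e‖ = 1) (ht : |t| * M ≤ 1 / 2) {r₀ r R : ℝ} (hr : r₀ < r) (hR : r₀ < R)
    (hsupp : ∀ x, r₀ < ‖x‖ → η x = 0) {E : Set (Rn n)} (hE : MeasurableSet E) :
    kPerimeter K (Metric.ball 0 R) (shear η e t '' E) +
        kPerimeter K (Metric.ball 0 R) (shear η e (-t) '' E) ≤
      2 * kPerimeter K (Metric.ball 0 R) E +
        ENNReal.ofReal (variationConst n s lam Lam * M ^ 2 * t ^ 2) *
          kPerimeter K (Metric.ball 0 r) E := by
  have hKm := hK.measurable hs hlam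
  have ht' : |-t| * M ≤ 1 / 2 := by rwa [abs_neg]
  have hbR : MeasurableSet (Metric.ball (0 : Rn n) R) := Metric.isOpen_ball.measurableSet
  have hbr : MeasurableSet (Metric.ball (0 : Rn n) r) := Metric.isOpen_ball.measurableSet
  have hs' : ∀ x, R ≤ ‖x‖ → η x = 0 := fun x hx => hsupp x (hR.trans_le hx)
  set c := ENNReal.ofReal (variationConst n s lam Lam * M ^ 2 * t ^ 2) with hc
  set k : Rn n × Rn n → ℝ≥0∞ := fun p => ENNReal.ofReal (K (p.1 - p.2)) with hk
  have hkm : Measurable k := measurable_kernel_sub hKm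
  set Q : Set (Rn n × Rn n) := {p | p.1 ∈ Metric.ball 0 r ∨ p.2 ∈ Metric.ball 0 r} with hQ
  have hQm : MeasurableSet Q := measurableSet_prod_or hbr
  rw [kPerimeter_shear hKm hη hM he ht hs' hE, kPerimeter_shear hKm hη hM he ht' hs' hE,
    kPerimeter_eq_setLIntegral hKm hbR hE, kPerimeter_eq_setLIntegral hKm hbr hE,
    ← lintegral_add_left (measurable_shearKernel hKm hη)]
  have hpt : ∀ p ∈ crossing (Metric.ball 0 R) E,
      shearKernel K η e t p + shearKernel K η e (-t) p ≤ 2 * k p + Q.indicator (fun p => c * k p) p := by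
    rintro ⟨x, y⟩ hp
    have hxy : x ≠ y := by
      rintro rfl
      exact hp.1.2 hp.1.1
    by_cases hq : (x, y) ∈ Q
    · rw [indicator_of_mem hq, ← add_mul]
      exact shearKernel_add_le hK hs hlam hM he ht hxy
    · rw [indicator_of_notMem hq, add_zero]
      simp only [hQ, mem_ofPred_eq, mem_ball_zero_iff, not_or, not_lt] at hq
      have h1 : ∀ z : Rn n, r ≤ ‖z‖ → ∀ σ, shear η e σ z = z ∧ shearJacobian η e σ z = 1 := by
        intro z hz σ
        have hz' : r₀ < ‖z‖ := hr.trans_le hz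
        refine ⟨shear_of_eq_zero (hsupp z hz'), ?_⟩
        have hloc : η =ᶠ[nhds z] fun _ => 0 := by
          filter_upwards [(isOpen_lt continuous_const continuous_norm).mem_nhds hz'] with w hw
          exact hsupp w hw
        rw [shearJacobian, hloc.fderiv_eq]
        simp
      have h2 : ∀ σ, shearKernel K η e σ (x, y) = k (x, y) := fun σ => by
        simp [shearKernel, hk, h1 x hq.1 σ, h1 y hq.2 σ]
      rw [h2, h2, two_mul]
  refine (setLIntegral_mono' (measurableSet_crossing hbR hE) hpt).trans ?_
  rw [lintegral_add_left (hkm.const_mul 2), lintegral_const_mul _ hkm]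
  gcongr
  rw [lintegral_indicator hQm, lintegral_const_mul _ hkm, Measure.restrict_restrict hQm]
  gcongr
  rintro ⟨x, y⟩ h
  exact ⟨h.2.1, h.1⟩

end Shear

variable {n : ℕ} {K : Rn n → ℝ}

/-! ### Submodularity of the nonlocal perimeter -/

/-- The inequality holds pair by pair. A pair in (F \ E) × (E \ F) crosses F but neither the union
nor the intersection, which leaves room for the extra term; `hsub` ensures that such a pair is
counted in Ω. -/
theorem kPerimeter_union_add_inter_add_le (hK : Measurable K) {Ω E F : Set (Rn n)}
    (hΩ : MeasurableSet Ω) (hE : MeasurableSet E) (hF : MeasurableSet F) (hsub : F \ E ⊆ Ω) :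
    kPerimeter K Ω (F ∪ E) + kPerimeter K Ω (F ∩ E) + interaction K (F \ E) (E \ F) ≤
      kPerimeter K Ω E + kPerimeter K Ω F := by
  set k : Rn n × Rn n → ℝ≥0∞ := fun p => ENNReal.ofReal (K (p.1 - p.2)) with hk
  have hkm : Measurable k := measurable_kernel_sub hK
  have hD : interaction K (F \ E) (E \ F) = ∫⁻ p in (F \ E) ×ˢ (E \ F), k p :=
    lintegral_lintegral_eq_setLIntegral_prod hkm
  have mU := measurableSet_crossing hΩ (hF.union hE)
  have mI := measurableSet_crossing hΩ (hF.inter hE)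
  have mE := measurableSet_crossing hΩ hE
  have mF := measurableSet_crossing hΩ hF
  have mD : MeasurableSet ((F \ E) ×ˢ (E \ F)) := (hF.diff hE).prod (hE.diff hF)
  rw [hD, kPerimeter_eq_setLIntegral hK hΩ (hF.union hE),
    kPerimeter_eq_setLIntegral hK hΩ (hF.inter hE), kPerimeter_eq_setLIntegral hK hΩ hE,
    kPerimeter_eq_setLIntegral hK hΩ hF, ← lintegral_indicator mU, ← lintegral_indicator mI,
    ← lintegral_indicator mE, ← lintegral_indicator mF, ← lintegral_indicator mD,
    ← lintegral_add_left (hkm.indicator mU), ← lintegral_add_right _ (hkm.indicator mD),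
    ← lintegral_add_left (hkm.indicator mE)]
  refine lintegral_mono fun p => ?_
  obtain ⟨x, y⟩ := p
  classical
  have hx : x ∈ F ∧ x ∉ E → x ∈ Ω := @hsub x
  have hind : ∀ (S : Set (Rn n × Rn n)) (P : Prop) [Decidable P], ((x, y) ∈ S ↔ P) →
      S.indicator k (x, y) = if P then k (x, y) else 0 := by
    intro S P _ h
    by_cases hP : P
    · rw [if_pos hP, indicator_of_mem (h.2 hP)]
    · rw [if_neg hP, indicator_of_notMem (fun h' => hP (h.1 h'))]
  have hcr : ∀ A : Set (Rn n), (crossing Ω A).indicator k (x, y) =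
      if (x ∈ A ∧ y ∉ A) ∧ (x ∈ Ω ∨ y ∈ Ω) then k (x, y) else 0 := fun A => hind _ _ Iff.rfl
  rw [hcr, hcr, hcr, hcr, hind ((F \ E) ×ˢ (E \ F)) ((x ∈ F ∧ x ∉ E) ∧ (y ∈ E ∧ y ∉ F)) Iff.rfl]
  clear hcr hind mU mI mE mF mD hD hkm hE hF hΩ hK
  generalize k (x, y) = κ
  simp only [mem_inter_iff, mem_union]
  by_cases h1 : x ∈ E <;> by_cases h2 : x ∈ F <;> by_cases h3 : y ∈ E <;> by_cases h4 : y ∈ F <;>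
    by_cases h5 : x ∈ Ω <;> simp_all

/-! ### Invariance under modification on null sets -/

theorem interaction_congr_ae {A A' B B' : Set (Rn n)} (hA : A =ᵐ[volume] A')
    (hB : B =ᵐ[volume] B') : interaction K A B = interaction K A' B' := by
  unfold interaction
  rw [Measure.restrict_congr_set hA, Measure.restrict_congr_set hB]

theorem kPerimeter_congr_ae {Ω E E' : Set (Rn n)} (h : E =ᵐ[volume] E') :
    kPerimeter K Ω E = kPerimeter K Ω E' := by
  have h' := h.compl
  unfold kPerimeter
  rw [interaction_congr_ae (h.inter (ae_eq_refl Ω)) (h'.inter (ae_eq_refl Ω)),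
    interaction_congr_ae (h.inter (ae_eq_refl Ω)) (h'.diff (ae_eq_refl Ω)),
    interaction_congr_ae (h.diff (ae_eq_refl Ω)) (h'.inter (ae_eq_refl Ω))]

theorem shear_image_congr_ae {η : Rn n → ℝ} (hη : ContDiff ℝ 2 η) (e : Rn n) (t : ℝ)
    {E E' : Set (Rn n)} (h : E =ᵐ[volume] E') :
    (shear η e t '' E : Set (Rn n)) =ᵐ[volume] (shear η e t '' E' : Set (Rn n)) := by
  have hd : Differentiable ℝ (shear η e t) := fun x => (hasFDerivAt_shear hη x).differentiableAt
  have key : ∀ A B : Set (Rn n), volume (A \ B) = 0 →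
      volume (shear η e t '' A \ shear η e t '' B) = 0 := fun A B hAB =>
    measure_mono_null (t := shear η e t '' (A \ B))
      (by rintro _ ⟨⟨x, hx, rfl⟩, hy⟩; exact ⟨x, ⟨hx, fun h => hy ⟨x, h, rfl⟩⟩, rfl⟩)
      (addHaar_image_eq_zero_of_differentiableOn_of_addHaar_eq_zero volume hd.differentiableOn hAB)
  rw [ae_eq_set] at h ⊢
  exact ⟨key _ _ h.1, key _ _ h.2⟩

/-- Stability with respect to the deformations `shear η e t`. -/
def IsShearStable (K : Rn n → ℝ) (E : Set (Rn n)) : Prop :=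
  kPerimeter K (Metric.ball 0 4) E < ∞ ∧
  ∀ (η : Rn n → ℝ) (r : ℝ) (e : Rn n), ContDiff ℝ 2 η → r < 4 → (∀ x, r < ‖x‖ → η x = 0) →
    ∀ ε : ℝ, 0 < ε → ∃ t₀ : ℝ, 0 < t₀ ∧ ∀ t, |t| < t₀ →
      kPerimeter K (Metric.ball 0 4) E ≤
        kPerimeter K (Metric.ball 0 4) (shear η e t '' E ∪ E) + ENNReal.ofReal (ε * t ^ 2) ∧
      kPerimeter K (Metric.ball 0 4) E ≤
        kPerimeter K (Metric.ball 0 4) (shear η e t '' E ∩ E) + ENNReal.ofReal (ε * t ^ 2)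

theorem IsStableSet.isShearStable_congr {E E' : Set (Rn n)}
    (hE : IsStableSet K (Metric.ball 0 4) E) (h : E =ᵐ[volume] E') : IsShearStable K E' := by
  refine ⟨kPerimeter_congr_ae (K := K) h ▸ hE.1, fun η r e hη hr hsupp ε hε => ?_⟩
  obtain ⟨t₀, ht₀, H⟩ := hE.shear hη hr hsupp e hε
  refine ⟨t₀, ht₀, fun t ht => ?_⟩
  have hF := shear_image_congr_ae hη e t h
  rw [← kPerimeter_congr_ae h, ← kPerimeter_congr_ae (hF.union h),
    ← kPerimeter_congr_ae (hF.inter h)]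
  exact H t ht

/-! ### The second variation inequality -/

/-- Stability for the union and the intersection, added and compared with submodularity, shows that
P(F_t) exceeds P(E) by at least the interaction, up to 2εt². Summing over t and -t against the
second order upper bound gives the claim. -/
theorem IsShearStable.interaction_le {s lam Lam : ℝ} (hK : KernelClassL2 s lam Lam K)
    (hs : 0 < s) (hlam : 0 < lam) {E : Set (Rn n)} (hEm : MeasurableSet E)
    (hE : IsShearStable K E) {η : Rn n → ℝ} {e : Rn n} {M : ℝ≥0} (hη : ContDiff ℝ 2 η)
    (hM : LipschitzWith M η) (he : ‖e‖ = 1) {r₀ r : ℝ} (hr₀ : r₀ < r) (hr₀' : r₀ < 4)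
    (hsupp : ∀ x, r₀ < ‖x‖ → η x = 0) {ε : ℝ} (hε : 0 < ε) :
    ∃ t₀ : ℝ, 0 < t₀ ∧ ∀ t, |t| < t₀ → |t| * M ≤ 1 / 2 ∧
      interaction K (shear η e t '' E \ E) (E \ shear η e t '' E) ≤
        ENNReal.ofReal (variationConst n s lam Lam * M ^ 2 * t ^ 2) *
          kPerimeter K (Metric.ball 0 r) E + 4 * ENNReal.ofReal (ε * t ^ 2) := by
  obtain ⟨hfin, hst⟩ := hE
  obtain ⟨t₀, ht₀, H⟩ := hst η r₀ e hη hr₀' hsupp ε hε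
  refine ⟨min t₀ (1 / (2 * (M + 1))), by positivity, fun t ht => ?_⟩
  have htM : |t| * M ≤ 1 / 2 := by
    have h1 : |t| ≤ 1 / (2 * (M + 1)) := (ht.trans_le (min_le_right _ _)).le
    rw [le_div_iff₀ (by positivity)] at h1
    nlinarith [abs_nonneg t, M.coe_nonneg]
  refine ⟨htM, ?_⟩
  have hKm := hK.measurable hs hlam
  have hb : MeasurableSet (Metric.ball (0 : Rn n) 4) := Metric.isOpen_ball.measurableSet
  have one_side : ∀ σ : ℝ, |σ| = |t| →
      kPerimeter K (Metric.ball 0 4) E + interaction K (shear η e σ '' E \ E) (E \ shear η e σ '' E)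
        ≤ kPerimeter K (Metric.ball 0 4) (shear η e σ '' E) + 2 * ENNReal.ofReal (ε * t ^ 2) := by
    intro σ hσ
    have hσM : |σ| * M ≤ 1 / 2 := by rwa [hσ]
    have hσ2 : σ ^ 2 = t ^ 2 := by rw [← sq_abs, hσ, sq_abs]
    obtain ⟨h1, h2⟩ := H σ (by rw [hσ]; exact ht.trans_le (min_le_left _ _))
    rw [hσ2] at h1 h2
    set F := shear η e σ '' E with hF
    have hFm : MeasurableSet F := hEm.image_of_continuousOn_injOn
      (continuous_shear hη).continuousOn (shear_injective hM he hσM).injOn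
    have hsub : F \ E ⊆ Metric.ball 0 4 := by
      rintro y ⟨⟨x, hx, rfl⟩, hy⟩
      by_contra h
      have h4 := (shear_mem_ball_iff hM he hσM (fun x hx => hsupp x (hr₀'.trans_le hx)) x).not.1 h
      have h5 : η x = 0 := hsupp x (hr₀'.trans_le (by simpa using h4))
      rw [shear_of_eq_zero h5] at hy
      exact hy hx
    have h3 := kPerimeter_union_add_inter_add_le hKm hb hEm hFm hsub
    set P := kPerimeter K (Metric.ball 0 4) E
    set δ := ENNReal.ofReal (ε * t ^ 2)
    set X := interaction K (F \ E) (E \ F)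
    -- Finiteness of P(E) allows one copy of it to be cancelled in `ℝ≥0∞`.
    refine (ENNReal.add_le_add_iff_left hfin.ne).1 ?_
    calc P + (P + X) = P + P + X := by ring
      _ ≤ (kPerimeter K (Metric.ball 0 4) (F ∪ E) + δ) +
          (kPerimeter K (Metric.ball 0 4) (F ∩ E) + δ) + X := by gcongr
      _ = kPerimeter K (Metric.ball 0 4) (F ∪ E) + kPerimeter K (Metric.ball 0 4) (F ∩ E) + X
          + 2 * δ := by ring
      _ ≤ P + kPerimeter K (Metric.ball 0 4) F + 2 * δ := by gcongr
      _ = _ := by ring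
  have h1 := one_side t rfl
  have h2 := one_side (-t) (abs_neg t)
  have h3 := kPerimeter_shear_add_le hK hs hlam hη hM he htM hr₀ hr₀' hsupp hEm
  set P := kPerimeter K (Metric.ball 0 4) E
  have hP2 : (2 : ℝ≥0∞) * P ≠ ∞ := ENNReal.mul_ne_top (by simp) hfin.ne
  refine (ENNReal.add_le_add_iff_left hP2).1 ?_
  -- The interaction term belonging to -t is simply dropped.
  refine le_trans ?_ ((add_le_add h1 h2).trans ?_)
  · rw [two_mul]
    refine le_trans (le_of_eq ?_) (add_le_add_right le_self_add _)
    ring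
  · refine le_trans (le_of_eq ?_) ((add_le_add_left h3 (4 * ENNReal.ofReal (ε * t ^ 2))).trans
      (le_of_eq ?_))
    · ring
    · ring

/-! ### Jump sets -/

/-- The points `x` such that `x` and `x + h` lie in `B_r` and are separated by `E`. -/
def jumpSet (E : Set (Rn n)) (r : ℝ) (h : Rn n) : Set (Rn n) :=
  {x | x ∈ Metric.ball 0 r ∧ x + h ∈ Metric.ball 0 r ∧ ¬(x ∈ E ↔ x + h ∈ E)}

theorem jumpSet_zero (E : Set (Rn n)) (r : ℝ) : jumpSet E r 0 = ∅ := by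
  simp [jumpSet]

theorem jumpSet_mono (E : Set (Rn n)) {r r' : ℝ} (h : r ≤ r') (v : Rn n) :
    jumpSet E r v ⊆ jumpSet E r' v := fun _ hx =>
  ⟨Metric.ball_subset_ball h hx.1, Metric.ball_subset_ball h hx.2.1, hx.2.2⟩

/-- If x and x + (N+1)h are separated, one of the steps x → x + Nh → x + (N+1)h crosses E. Convexity
of the ball keeps the intermediate point inside, and translation invariance gives equal volumes. -/
theorem volume_jumpSet_nsmul_le (E : Set (Rn n)) (r : ℝ) (h : Rn n) (N : ℕ) :
    volume (jumpSet E r ((N : ℝ) • h)) ≤ N * volume (jumpSet E r h) := by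
  induction N with
  | zero => simp [jumpSet_zero]
  | succ N ih =>
    have hsub : jumpSet E r (((N + 1 : ℕ) : ℝ) • h) ⊆
        jumpSet E r ((N : ℝ) • h) ∪ (fun x => x + (N : ℝ) • h) ⁻¹' jumpSet E r h := by
      rintro x ⟨h1, h2, h3⟩
      have e1 : x + ((N + 1 : ℕ) : ℝ) • h = x + (N : ℝ) • h + h := by
        push_cast; module
      have hmid : x + (N : ℝ) • h ∈ Metric.ball (0 : Rn n) r := by
        have hN : (0 : ℝ) < (N : ℝ) + 1 := by positivity
        have := (convex_ball (0 : Rn n) r) h1 h2 (a := 1 / ((N : ℝ) + 1)) (b := N / ((N : ℝ) + 1))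
          (by positivity) (by positivity) (by field_simp; ring)
        convert this using 1
        push_cast
        match_scalars
        · field_simp; ring
        · field_simp
      rw [e1] at h2 h3
      by_cases hE : x ∈ E ↔ x + (N : ℝ) • h ∈ E
      · exact Or.inr ⟨hmid, h2, fun h4 => h3 (hE.trans h4)⟩
      · exact Or.inl ⟨h1, hmid, hE⟩
    refine (measure_mono hsub).trans ((measure_union_le _ _).trans ?_)
    rw [measure_preimage_add_right]
    push_cast
    rw [add_mul, one_mul]
    gcongr

/-- Stability says something only for times below a threshold depending on E. Dividing σ into small
equal steps removes the threshold without changing the constant. -/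
theorem volume_jumpSet_le_of_small (E : Set (Rn n)) (r : ℝ) (e : Rn n) {v t₀ : ℝ} (ht₀ : 0 < t₀)
    (hv : ∀ t, 0 < t → t < t₀ → volume (jumpSet E r (t • e)) ≤ ENNReal.ofReal (v * t)) {σ : ℝ}
    (hσ : 0 < σ) : volume (jumpSet E r (σ • e)) ≤ ENNReal.ofReal (v * σ) := by
  obtain ⟨N, hN⟩ := exists_nat_gt (σ / t₀)
  have hN0 : (0 : ℝ) < N := (div_pos hσ ht₀).trans hN
  have h1 := volume_jumpSet_nsmul_le E r ((σ / N) • e) N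
  rw [smul_smul, mul_div_cancel₀ _ hN0.ne'] at h1
  refine h1.trans ((mul_le_mul_right (hv (σ / N) (by positivity) ?_) _).trans (le_of_eq ?_))
  · rw [div_lt_iff₀ hN0]
    rw [div_lt_iff₀ ht₀] at hN
    linarith
  · rw [← ENNReal.ofReal_natCast, ← ENNReal.ofReal_mul hN0.le]
    congr 1
    field_simp

/-! ### Cutoff functions -/

/-- The function is C¹ on the compact interval [0, 1] and factors through the projection onto it. -/
theorem exists_lipschitzWith_smoothTransition : ∃ L : ℝ≥0, LipschitzWith L Real.smoothTransition := by
  obtain ⟨L, hL⟩ := (Real.smoothTransition.contDiff (n := 1)).contDiffOn.exists_lipschitzOnWith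
    (by norm_num) (convex_Icc (0 : ℝ) 1) isCompact_Icc
  refine ⟨L, LipschitzWith.of_dist_le_mul fun x y => ?_⟩
  rw [← Real.smoothTransition.projIcc (x := x), ← Real.smoothTransition.projIcc (x := y)]
  refine (hL.dist_le_mul _ (projIcc 0 1 zero_le_one x).2 _ (projIcc 0 1 zero_le_one y).2).trans ?_
  have h1 := (LipschitzWith.projIcc (zero_le_one (α := ℝ))).dist_le_mul x y
  rw [NNReal.coe_one, one_mul] at h1
  gcongr
  exact h1

theorem exists_cutoff (n : ℕ) : ∃ C : ℝ, 0 ≤ C ∧ ∀ ρ ρ' : ℝ, 0 < ρ → ρ < ρ' →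
    ∃ (η : Rn n → ℝ) (M : ℝ≥0), ContDiff ℝ 2 η ∧ LipschitzWith M η ∧ (M : ℝ) ≤ C / (ρ' - ρ) ∧
      (∀ x, ‖x‖ ≤ ρ → η x = 1) ∧ ∀ x, ρ' < ‖x‖ → η x = 0 := by
  obtain ⟨L, hL⟩ := exists_lipschitzWith_smoothTransition
  refine ⟨2 * L, by positivity, fun ρ ρ' hρ hρ' => ?_⟩
  have hd : 0 < ρ' ^ 2 - ρ ^ 2 := by nlinarith
  have hd' : 0 < ρ' - ρ := sub_pos.2 hρ'
  have hρ'0 : 0 < ρ' := hρ.trans hρ'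
  let η : Rn n → ℝ := fun x => Real.smoothTransition ((ρ' ^ 2 - ‖x‖ ^ 2) / (ρ' ^ 2 - ρ ^ 2))
  refine ⟨η, (2 * L / (ρ' - ρ)).toNNReal, ?_, ?_, ?_, ?_, ?_⟩
  · exact Real.smoothTransition.contDiff.comp
      ((contDiff_const.sub (contDiff_norm_sq ℝ)).div_const _)
  · refine LipschitzWith.of_dist_le_mul fun x y => ?_
    -- ‖x‖² keeps η smooth at the origin but is not globally Lipschitz; since η vanishes beyond ρ',
    -- the norm may be truncated there.
    have h0 : ∀ z : Rn n, η z =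
        Real.smoothTransition ((ρ' ^ 2 - min ‖z‖ ρ' ^ 2) / (ρ' ^ 2 - ρ ^ 2)) := by
      intro z
      rcases le_total ‖z‖ ρ' with h | h
      · rw [min_eq_left h]
      · rw [min_eq_right h, sub_self, zero_div, Real.smoothTransition.zero]
        refine Real.smoothTransition.zero_of_nonpos (div_nonpos_of_nonpos_of_nonneg ?_ hd.le)
        nlinarith
    have h1 : |min ‖x‖ ρ' - min ‖y‖ ρ'| ≤ dist x y := by
      refine (abs_min_sub_min_le_max _ _ _ _).trans ?_
      rw [sub_self, abs_zero, max_eq_left (abs_nonneg _), dist_eq_norm]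
      exact abs_norm_sub_norm_le x y
    have h2 : |min ‖x‖ ρ' ^ 2 - min ‖y‖ ρ' ^ 2| ≤ 2 * ρ' * dist x y := by
      have h3 : |min ‖x‖ ρ' + min ‖y‖ ρ'| ≤ 2 * ρ' := by
        rw [abs_of_nonneg (by positivity)]
        linarith [min_le_right ‖x‖ ρ', min_le_right ‖y‖ ρ']
      rw [sq_sub_sq, abs_mul]
      gcongr
    rw [h0, h0, Real.coe_toNNReal _ (by positivity)]
    refine (hL.dist_le_mul _ _).trans ?_
    rw [Real.dist_eq, ← sub_div, sub_sub_sub_cancel_left, abs_div, abs_of_pos hd, abs_sub_comm]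
    calc (L : ℝ) * (|min ‖x‖ ρ' ^ 2 - min ‖y‖ ρ' ^ 2| / (ρ' ^ 2 - ρ ^ 2))
        ≤ L * (2 * ρ' * dist x y / (ρ' ^ 2 - ρ ^ 2)) := by gcongr
      _ = 2 * L * dist x y * (ρ' / (ρ' ^ 2 - ρ ^ 2)) := by ring
      _ ≤ 2 * L * dist x y * (1 / (ρ' - ρ)) := by
        gcongr 2 * L * dist x y * ?_
        rw [div_le_div_iff₀ hd hd']
        nlinarith
      _ = _ := by ring
  · rw [Real.coe_toNNReal _ (by positivity)]
  · intro x hx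
    refine Real.smoothTransition.one_of_one_le ?_
    rw [one_le_div hd]
    have : ‖x‖ ^ 2 ≤ ρ ^ 2 := by gcongr
    linarith
  · intro x hx
    refine Real.smoothTransition.zero_of_nonpos (div_nonpos_of_nonpos_of_nonneg ?_ hd.le)
    have : ρ' ^ 2 ≤ ‖x‖ ^ 2 := pow_le_pow_left₀ hρ'0.le hx.le 2
    linarith

/-! ### Volumes of shells -/

/-- The constant in the volume estimate for shells. -/
noncomputable def shellConst (n : ℕ) : ℝ :=
  n * 4 ^ (n - 1) * volume.real (Metric.ball (0 : Rn n) 1)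

theorem shellConst_nonneg (n : ℕ) : 0 ≤ shellConst n := by
  unfold shellConst; positivity

theorem volume_real_ball_sub_le [Nontrivial (Rn n)] {ρ ρ' : ℝ} (h0 : 0 ≤ ρ) (h : ρ ≤ ρ') (h4 : ρ' ≤ 4) :
    volume.real (Metric.ball (0 : Rn n) ρ') - volume.real (Metric.ball (0 : Rn n) ρ) ≤
      shellConst n * (ρ' - ρ) := by
  rw [Measure.real, Measure.real, Measure.addHaar_ball _ _ h0, Measure.addHaar_ball _ _ (h0.trans h),
    ENNReal.toReal_mul, ENNReal.toReal_mul, ENNReal.toReal_ofReal (pow_nonneg (h0.trans h) _),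
    ENNReal.toReal_ofReal (pow_nonneg h0 _), finrank_euclideanSpace_fin, ← sub_mul]
  have h1 : ρ' ^ n - ρ ^ n ≤ n * 4 ^ (n - 1) * (ρ' - ρ) := by
    have h2 := abs_pow_sub_pow_le ρ' ρ n
    rw [abs_of_nonneg (sub_nonneg.2 h), abs_of_nonneg h0, abs_of_nonneg (h0.trans h),
      max_eq_left h] at h2
    refine (le_abs_self _).trans (h2.trans ?_)
    have h3 : ρ' ^ (n - 1) ≤ 4 ^ (n - 1) := pow_le_pow_left₀ (h0.trans h) h4 _
    have h4 : 0 ≤ ρ' - ρ := sub_nonneg.2 h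
    calc (ρ' - ρ) * n * ρ' ^ (n - 1) ≤ (ρ' - ρ) * n * 4 ^ (n - 1) := by gcongr
      _ = _ := by ring
  calc _ ≤ (n * 4 ^ (n - 1) * (ρ' - ρ)) * (volume (Metric.ball (0 : Rn n) 1)).toReal := by gcongr
    _ = _ := by unfold shellConst Measure.real; ring

theorem volume_real_ball_inter_sub_le [Nontrivial (Rn n)] (E : Set (Rn n)) {ρ ρ' : ℝ} (h0 : 0 ≤ ρ) (h : ρ ≤ ρ')
    (h4 : ρ' ≤ 4) :
    volume.real (Metric.ball (0 : Rn n) ρ' ∩ E) ≤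
      volume.real (Metric.ball (0 : Rn n) ρ ∩ E) + shellConst n * (ρ' - ρ) := by
  have hsub : Metric.ball (0 : Rn n) ρ ⊆ Metric.ball 0 ρ' := Metric.ball_subset_ball h
  have hb := volume_real_ball_sub_le (n := n) h0 h h4
  rw [← measureReal_sdiff hsub Metric.isOpen_ball.measurableSet measure_ball_lt_top.ne] at hb
  have h1 : Metric.ball (0 : Rn n) ρ' ∩ E ⊆
      (Metric.ball (0 : Rn n) ρ ∩ E) ∪ (Metric.ball 0 ρ' \ Metric.ball 0 ρ) := by
    rintro x ⟨hx, hxE⟩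
    by_cases hx' : x ∈ Metric.ball (0 : Rn n) ρ
    · exact Or.inl ⟨hx', hxE⟩
    · exact Or.inr ⟨hx, hx'⟩
  have hf : ∀ σ, volume (Metric.ball (0 : Rn n) σ) ≠ ∞ := fun σ => measure_ball_lt_top.ne
  refine (measureReal_mono h1 (measure_union_ne_top (measure_ne_top_of_subset inter_subset_left (hf _))
    (measure_ne_top_of_subset sdiff_subset (hf _)))).trans ((measureReal_union_le _ _).trans ?_)
  linarith

/-- Translating `E` by `v` changes its volume in a ball by at most a multiple of `|v|`. -/
theorem abs_volume_real_translate_sub_le [Nontrivial (Rn n)] (E : Set (Rn n)) {r : ℝ} {v : Rn n} (hv : ‖v‖ ≤ r)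
    (h4 : r + ‖v‖ ≤ 4) :
    |volume.real (Metric.ball (0 : Rn n) r ∩ {x | x + v ∈ E}) -
      volume.real (Metric.ball (0 : Rn n) r ∩ E)| ≤ shellConst n * ‖v‖ := by
  have hf : ∀ σ, volume (Metric.ball (0 : Rn n) σ) ≠ ∞ := fun σ => measure_ball_lt_top.ne
  have hr : 0 ≤ r := (norm_nonneg v).trans hv
  have e1 : volume.real (Metric.ball (0 : Rn n) r ∩ {x | x + v ∈ E}) =
      volume.real (Metric.ball (-(-v)) r ∩ E) := by
    have : Metric.ball (0 : Rn n) r ∩ {x | x + v ∈ E} =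
        (fun x => x + v) ⁻¹' (Metric.ball (-(-v)) r ∩ E) := by
      ext x
      simp
    rw [this, Measure.real, Measure.real, measure_preimage_add_right]
  rw [neg_neg] at e1
  rw [e1, abs_le]
  -- The ball of radius r about v lies between the balls about 0 of radii r - ‖v‖ and r + ‖v‖, so
  -- each side is a shell estimate.
  constructor
  · have h1 := volume_real_ball_inter_sub_le E (sub_nonneg.2 hv) (sub_le_self r (norm_nonneg v))
      (by linarith [norm_nonneg v])
    have h2 : volume.real (Metric.ball (0 : Rn n) (r - ‖v‖) ∩ E) ≤
        volume.real (Metric.ball v r ∩ E) :=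
      measureReal_mono (inter_subset_inter_left _ (Metric.ball_subset_ball' (by simp)))
        (measure_ne_top_of_subset inter_subset_left measure_ball_lt_top.ne)
    have e2 : r - (r - ‖v‖) = ‖v‖ := by ring
    rw [e2] at h1
    linarith
  · have h1 := volume_real_ball_inter_sub_le E hr (le_add_of_nonneg_right (norm_nonneg v)) h4
    have h2 : volume.real (Metric.ball v r ∩ E) ≤
        volume.real (Metric.ball (0 : Rn n) (r + ‖v‖) ∩ E) :=
      measureReal_mono (inter_subset_inter_left _ (Metric.ball_subset_ball' (by simp)))
        (measure_ne_top_of_subset inter_subset_left (hf _))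
    rw [add_sub_cancel_left] at h1
    linarith

variable {s lam Lam : ℝ}

/-! ### From the nonlocal perimeter to the jump sets -/

/-- Points of B_4 are at distance at most 8, where the kernel is bounded below. -/
theorem KernelClassL2.mul_volume_le_interaction (hK : KernelClassL2 s lam Lam K) (hs : 0 < s)
    (hlam : 0 < lam) {A B : Set (Rn n)} (hA : MeasurableSet A) (hB : MeasurableSet B)
    (hA4 : A ⊆ Metric.ball 0 4) (hB4 : B ⊆ Metric.ball 0 4) (hAB : Disjoint A B) :
    ENNReal.ofReal (lam / 8 ^ ((n : ℝ) + s)) * volume A * volume B ≤ interaction K A B := by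
  set c := ENNReal.ofReal (lam / 8 ^ ((n : ℝ) + s))
  have h1 : ∀ x ∈ A, c * volume B ≤ ∫⁻ y in B, ENNReal.ofReal (K (x - y)) := by
    intro x hx
    rw [← setLIntegral_const]
    refine setLIntegral_mono' hB fun y hy => ENNReal.ofReal_le_ofReal ?_
    have hz : x - y ≠ 0 := sub_ne_zero.2 (hAB.ne_of_mem hx hy)
    have hr : 0 < ‖x - y‖ := norm_pos_iff.2 hz
    have h8 : ‖x - y‖ ≤ 8 := by
      have h2 := mem_ball_zero_iff.1 (hA4 hx)
      have h3 := mem_ball_zero_iff.1 (hB4 hy)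
      linarith [norm_sub_le x y]
    refine le_trans ?_ (hK.lower _ hz)
    have : ‖x - y‖ ^ ((n : ℝ) + s) ≤ 8 ^ ((n : ℝ) + s) :=
      Real.rpow_le_rpow hr.le h8 (by positivity)
    have h0 : 0 < ‖x - y‖ ^ ((n : ℝ) + s) := Real.rpow_pos_of_pos hr _
    gcongr
  calc c * volume A * volume B = ∫⁻ _ in A, c * volume B := by rw [setLIntegral_const]; ring
    _ ≤ _ := setLIntegral_mono' hA h1

theorem interaction_mono {A A' B B' : Set (Rn n)} (hA : A ⊆ A') (hB : B ⊆ B') :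
    interaction K A B ≤ interaction K A' B' := by
  unfold interaction
  exact (lintegral_mono fun x => lintegral_mono_set hB).trans (lintegral_mono_set hA)

/-- Comparison of a sheared set with a translated one in the region where the cutoff is one. -/
theorem mem_shear_image_iff {η : Rn n → ℝ} {e : Rn n} {t : ℝ} (E : Set (Rn n)) {x : Rn n}
    (hinj : Function.Injective (shear η e (-t))) (hx : η (x + t • e) = 1) :
    x ∈ shear η e (-t) '' E ↔ x + t • e ∈ E := by
  have h : shear η e (-t) (x + t • e) = x := by
    rw [shear, hx]; module
  constructor
  · rintro ⟨y, hy, hyx⟩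
    rwa [hinj (h.trans hyx.symm)]
  · intro hE
    exact ⟨_, hE, h⟩

/-- The identity (a + b)² = (a - b)² + 4ab combines the shell bound on a - b with the stability
bound on ab. Only v² is linear in p, so v grows like its square root. -/
theorem exists_volume_jumpSet_le_of_kPerimeter_le [Nontrivial (Rn n)] (hs : 0 < s)
    (hlam : 0 < lam) (hLam : lam ≤ Lam) :
    ∃ C : ℝ, 0 < C ∧ ∀ K : Rn n → ℝ, KernelClassL2 s lam Lam K → ∀ E : Set (Rn n),
      MeasurableSet E → IsShearStable K E → ∀ r R : ℝ, 1 ≤ r → r < R → R ≤ 4 →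
      ∀ p : ℝ, 0 ≤ p → kPerimeter K (Metric.ball 0 R) E ≤ ENNReal.ofReal p →
      ∀ v : ℝ, 0 ≤ v → C * (1 + p / (R - r) ^ 2) ≤ v ^ 2 →
      ∀ h, volume (jumpSet E r h) ≤ ENNReal.ofReal (v * ‖h‖) := by
  obtain ⟨C₀, hC₀, hcut⟩ := exists_cutoff n
  have hLam0 : 0 < Lam := hlam.trans_le hLam
  set c := variationConst n s lam Lam with hc
  have hc0 : 0 < c := by rw [hc, variationConst]; positivity
  set c₁ : ℝ := lam / 8 ^ ((n : ℝ) + s) with hc₁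
  have hc₁0 : 0 < c₁ := by positivity
  set S := shellConst n
  have hS0 : 0 ≤ S := shellConst_nonneg n
  -- S² comes from (a - b)² and 4 / c₁ from 4ab. Inside, 4 is the stability error with ε = 1, and 16
  -- arises because the cutoff drops over a width (R - r)/4.
  refine ⟨S ^ 2 + 4 / c₁ * (4 + 16 * c * C₀ ^ 2), by positivity, ?_⟩
  intro K hK E hEm hE r R hr hrR hR p hp hP v hv hCv h
  have hd : 0 < R - r := sub_pos.2 hrR
  rcases eq_or_ne h 0 with rfl | hh
  · simp [jumpSet_zero]
  have hh0 : 0 < ‖h‖ := norm_pos_iff.2 hh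
  set e : Rn n := ‖h‖⁻¹ • h with he
  have he1 : ‖e‖ = 1 := by rw [he, norm_smul, norm_inv, norm_norm, inv_mul_cancel₀ hh0.ne']
  have hhe : h = ‖h‖ • e := by rw [he, smul_smul, mul_inv_cancel₀ hh0.ne', one_smul]
  -- The first quarter of the gap leaves room for x + te with x in B_r, where η must be 1; the
  -- support ends halfway, strictly inside B_R.
  obtain ⟨η, M, hη, hM, hMle, hη1, hη0⟩ := hcut (r + (R - r) / 4) (r + (R - r) / 2)
    (by linarith) (by linarith)
  obtain ⟨t₀, ht₀, H⟩ := hE.interaction_le hK hs hlam hEm hη hM he1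
    (r₀ := r + (R - r) / 2) (r := R) (by linarith) (by linarith) hη0 one_pos
  have hsmall : ∀ t, 0 < t → t < min t₀ (min ((R - r) / 4) 1) →
      volume (jumpSet E r (t • e)) ≤ ENNReal.ofReal (v * t) := by
    intro t ht htlt
    have ht1 : t < t₀ := htlt.trans_le (min_le_left _ _)
    have ht2 : t < (R - r) / 4 := htlt.trans_le ((min_le_right _ _).trans (min_le_left _ _))
    have ht3 : t < 1 := htlt.trans_le ((min_le_right _ _).trans (min_le_right _ _))
    -- With the sign -t, membership of x in the sheared set means x + te ∈ E, matching the
    -- definition of the jump set.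
    obtain ⟨htM, hint⟩ := H (-t) (by rw [abs_neg, abs_of_pos ht]; exact ht1)
    have hinj := shear_injective hM he1 htM
    have hmem : ∀ x ∈ Metric.ball (0 : Rn n) r, (x ∈ shear η e (-t) '' E ↔ x + t • e ∈ E) := by
      intro x hx
      refine mem_shear_image_iff E hinj (hη1 _ ?_)
      refine (norm_add_le _ _).trans ?_
      rw [norm_smul, he1, mul_one, Real.norm_of_nonneg ht.le]
      linarith [mem_ball_zero_iff.1 hx]
    have hE' : MeasurableSet {x | x + t • e ∈ E} := (measurable_id.add_const _) hEm
    have hbm : MeasurableSet (Metric.ball (0 : Rn n) r) := Metric.isOpen_ball.measurableSet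
    set A : Set (Rn n) := (Metric.ball 0 r ∩ {x | x + t • e ∈ E}) \ E with hA
    set B : Set (Rn n) := (Metric.ball 0 r ∩ E) \ {x | x + t • e ∈ E} with hB
    have hAm : MeasurableSet A := (hbm.inter hE').diff hEm
    have hBm : MeasurableSet B := (hbm.inter hEm).diff hE'
    have hb4 : Metric.ball (0 : Rn n) r ⊆ Metric.ball 0 4 := Metric.ball_subset_ball (by linarith)
    have hAfin : volume A ≠ ∞ := measure_ne_top_of_subset
      (fun x hx => hx.1.1) (measure_ball_lt_top (x := (0 : Rn n)) (r := r)).ne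
    have hBfin : volume B ≠ ∞ := measure_ne_top_of_subset
      (fun x hx => hx.1.1) (measure_ball_lt_top (x := (0 : Rn n)) (r := r)).ne
    have hAB : Disjoint A B := by
      rw [disjoint_left]
      intro x hx hx'
      exact hx.2 hx'.1.2
    set a := volume.real A with ha
    set b := volume.real B with hb
    have ha0 : 0 ≤ a := measureReal_nonneg
    have hb0 : 0 ≤ b := measureReal_nonneg
    have hvA : volume A = ENNReal.ofReal a := (ENNReal.ofReal_toReal hAfin).symm
    have hvB : volume B = ENNReal.ofReal b := (ENNReal.ofReal_toReal hBfin).symm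
    -- the product estimate
    have hprod : c₁ * a * b ≤ (c * M ^ 2 * p + 4) * t ^ 2 := by
      have h1 := hK.mul_volume_le_interaction hs hlam hAm hBm (fun x hx => hb4 hx.1.1)
        (fun x hx => hb4 hx.1.1) hAB
      have h2 : interaction K A B ≤
          interaction K (shear η e (-t) '' E \ E) (E \ shear η e (-t) '' E) := by
        refine interaction_mono ?_ ?_
        · intro x hx
          exact ⟨(hmem x hx.1.1).2 hx.1.2, hx.2⟩
        · intro x hx
          exact ⟨hx.1.2, fun h' => hx.2 ((hmem x hx.1.1).1 h')⟩
      have h3 := h1.trans (h2.trans hint)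
      rw [hvA, hvB, ← ENNReal.ofReal_mul hc₁0.le, ← ENNReal.ofReal_mul (by positivity),
        neg_sq] at h3
      have h4 : ENNReal.ofReal (c * M ^ 2 * t ^ 2) * kPerimeter K (Metric.ball 0 R) E +
          4 * ENNReal.ofReal (1 * t ^ 2) ≤ ENNReal.ofReal ((c * M ^ 2 * p + 4) * t ^ 2) := by
        refine (add_le_add_left (mul_le_mul_right hP _) _).trans (le_of_eq ?_)
        rw [← ENNReal.ofReal_mul (by positivity), one_mul,
          show (4 : ℝ≥0∞) = ENNReal.ofReal 4 by norm_num, ← ENNReal.ofReal_mul (by norm_num),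
          ← ENNReal.ofReal_add (by positivity) (by positivity)]
        congr 1; ring
      exact (ENNReal.ofReal_le_ofReal_iff (by positivity)).1 (h3.trans h4)
    -- the difference estimate
    have hdiff : |a - b| ≤ S * t := by
      have hte : ‖t • e‖ = t := by rw [norm_smul, he1, mul_one, Real.norm_of_nonneg ht.le]
      have h1 := abs_volume_real_translate_sub_le E (r := r) (v := t • e) (by rw [hte]; linarith)
        (by rw [hte]; linarith)
      rw [hte] at h1
      have hf : ∀ X : Set (Rn n), volume (Metric.ball (0 : Rn n) r ∩ X) ≠ ∞ := fun X =>
        measure_ne_top_of_subset inter_subset_left measure_ball_lt_top.ne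
      have h2 := measureReal_sdiff_add_inter (μ := volume)
        (s := Metric.ball (0 : Rn n) r ∩ {x | x + t • e ∈ E}) hEm (hf _)
      have h3 := measureReal_sdiff_add_inter (μ := volume)
        (s := Metric.ball (0 : Rn n) r ∩ E) hE' (hf _)
      have h4 : Metric.ball (0 : Rn n) r ∩ {x | x + t • e ∈ E} ∩ E =
          Metric.ball (0 : Rn n) r ∩ E ∩ {x | x + t • e ∈ E} := by
        rw [inter_assoc, inter_assoc, inter_comm E]
      rw [h4] at h2
      have h5 : a - b = volume.real (Metric.ball (0 : Rn n) r ∩ {x | x + t • e ∈ E}) -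
          volume.real (Metric.ball (0 : Rn n) r ∩ E) := by
        rw [ha, hb, ← h2, ← h3]; ring
      rw [h5]
      exact h1
    have hM2 : c * M ^ 2 * p ≤ 16 * c * C₀ ^ 2 * (p / (R - r) ^ 2) := by
      have h1 : (M : ℝ) ≤ 4 * C₀ / (R - r) := by
        refine hMle.trans (le_of_eq ?_)
        have : r + (R - r) / 2 - (r + (R - r) / 4) = (R - r) / 4 := by ring
        rw [this]; field_simp
      calc c * M ^ 2 * p ≤ c * (4 * C₀ / (R - r)) ^ 2 * p := by gcongr
        _ = _ := by field_simp; ring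
    have hsq : (a + b) ^ 2 ≤ (v * t) ^ 2 := by
      have h1 : (a - b) ^ 2 ≤ (S * t) ^ 2 := by
        rw [← sq_abs (a - b)]; gcongr
      have h2 : a * b ≤ (c * M ^ 2 * p + 4) * t ^ 2 / c₁ := by
        rw [le_div_iff₀ hc₁0]; linarith
      have hp' : 0 ≤ p / (R - r) ^ 2 := by positivity
      have h3 : (c * M ^ 2 * p + 4) * t ^ 2 / c₁ ≤
          1 / c₁ * (4 + 16 * c * C₀ ^ 2) * (1 + p / (R - r) ^ 2) * t ^ 2 := by
        have : c * M ^ 2 * p + 4 ≤ (4 + 16 * c * C₀ ^ 2) * (1 + p / (R - r) ^ 2) := by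
          have : 0 ≤ 16 * c * C₀ ^ 2 := by positivity
          nlinarith
        calc (c * M ^ 2 * p + 4) * t ^ 2 / c₁ ≤
            ((4 + 16 * c * C₀ ^ 2) * (1 + p / (R - r) ^ 2)) * t ^ 2 / c₁ := by gcongr
          _ = _ := by ring
      have h4 : S ^ 2 * t ^ 2 ≤ S ^ 2 * (1 + p / (R - r) ^ 2) * t ^ 2 := by
        gcongr
        exact le_mul_of_one_le_right (by positivity) (by linarith)
      calc (a + b) ^ 2 = (a - b) ^ 2 + 4 * (a * b) := by ring
        _ ≤ S ^ 2 * (1 + p / (R - r) ^ 2) * t ^ 2 +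
            4 * (1 / c₁ * (4 + 16 * c * C₀ ^ 2) * (1 + p / (R - r) ^ 2) * t ^ 2) := by
          rw [mul_pow] at h1; linarith
        _ = (S ^ 2 + 4 / c₁ * (4 + 16 * c * C₀ ^ 2)) * (1 + p / (R - r) ^ 2) * t ^ 2 := by ring
        _ ≤ v ^ 2 * t ^ 2 := by gcongr
        _ = _ := by ring
    have hab : a + b ≤ v * t := by
      have := sq_le_sq.1 hsq
      rwa [abs_of_nonneg (by positivity), abs_of_nonneg (by positivity)] at this
    have hsub : jumpSet E r (t • e) ⊆ A ∪ B := by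
      rintro x ⟨hx, -, hne⟩
      by_cases hxE : x ∈ E
      · exact Or.inr ⟨⟨hx, hxE⟩, fun h' => hne (iff_of_true hxE h')⟩
      · refine Or.inl ⟨⟨hx, ?_⟩, hxE⟩
        by_contra h'
        exact hne (iff_of_false hxE h')
    refine (measure_mono hsub).trans ((measure_union_le _ _).trans ?_)
    rw [hvA, hvB, ← ENNReal.ofReal_add ha0 hb0]
    exact ENNReal.ofReal_le_ofReal hab
  have := volume_jumpSet_le_of_small E r e (by positivity) hsmall hh0
  rwa [← hhe] at this

/-! ### From the jump sets to the nonlocal perimeter -/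

/-- Here s < 1 enters: one factor |h| gained from the jump bound makes the singularity of the kernel
integrable. -/
theorem lintegral_norm_rpow_ball_lt_top [Nontrivial (Rn n)] (hs₁ : s < 1) :
    ∫⁻ h in Metric.ball (0 : Rn n) 1, ENNReal.ofReal (‖h‖ ^ (-((n : ℝ) + s - 1))) < ∞ := by
  have hn : 1 ≤ Module.finrank ℝ (Rn n) := Module.finrank_pos
  have hi : IntegrableOn (fun h : Rn n => ‖h‖ ^ (-((n : ℝ) + s - 1))) (Metric.ball 0 1) volume := by
    refine integrableOn_ball_of_norm_le_rpow hn (C := 1) (α := (n : ℝ) + s - 1) ?_ ?_ ?_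
    · rw [finrank_euclideanSpace_fin]; linarith
    · refine Filter.Eventually.of_forall fun x => ?_
      rw [one_mul, Real.norm_of_nonneg (by positivity)]
    · exact (measurable_norm.pow_const _).aestronglyMeasurable
  exact hi.lintegral_lt_top

theorem lintegral_one_add_norm_rpow_lt_top (hs : 0 < s) :
    ∫⁻ h : Rn n, ENNReal.ofReal ((1 + ‖h‖) ^ (-((n : ℝ) + s))) < ∞ :=
  finite_integral_one_add_norm (by rw [finrank_euclideanSpace_fin]; linarith)

/-- The points of `B_r` separated by `E` from their translate by `h`. -/
def separatedSet (E : Set (Rn n)) (r : ℝ) (h : Rn n) : Set (Rn n) :=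
  {x | x ∈ Metric.ball 0 r ∧ ¬(x ∈ E ↔ x + h ∈ E)}

/-- A crossing pair has a member in B_r, which may be taken first by evenness of K; this costs the
factor 2. Substituting y = x + h and exchanging integrals finishes. -/
theorem kPerimeter_le_lintegral_separatedSet (hK : Measurable K) (hKe : ∀ z, K (-z) = K z)
    {E : Set (Rn n)} (hE : MeasurableSet E) (r : ℝ) :
    kPerimeter K (Metric.ball 0 r) E ≤
      2 * ∫⁻ h, ENNReal.ofReal (K h) * volume (separatedSet E r h) := by
  have hb : MeasurableSet (Metric.ball (0 : Rn n) r) := Metric.isOpen_ball.measurableSet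
  set k : Rn n × Rn n → ℝ≥0∞ := fun p => ENNReal.ofReal (K (p.1 - p.2)) with hk
  have hkm : Measurable k := measurable_kernel_sub hK
  set D : Set (Rn n × Rn n) := (E ×ˢ Eᶜ) ∪ (Eᶜ ×ˢ E) with hD
  have hDm : MeasurableSet D := (hE.prod hE.compl).union (hE.compl.prod hE)
  set S : Set (Rn n × Rn n) := (Metric.ball 0 r ×ˢ univ) ∩ D with hS
  have hSm : MeasurableSet S := (hb.prod MeasurableSet.univ).inter hDm
  have hDmem : ∀ x y, (x, y) ∈ D ↔ ¬(x ∈ E ↔ y ∈ E) := by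
    intro x y
    simp only [hD, mem_union, mem_prod, mem_compl_iff]
    tauto
  have hsub : crossing (Metric.ball 0 r) E ⊆ S ∪ Prod.swap ⁻¹' S := by
    rintro ⟨x, y⟩ ⟨⟨hx, hy⟩, hxy⟩
    rcases hxy with h | h
    · exact Or.inl ⟨⟨h, mem_univ _⟩, Or.inl ⟨hx, hy⟩⟩
    · exact Or.inr ⟨⟨h, mem_univ _⟩, Or.inr ⟨hy, hx⟩⟩
  have hswap : ∫⁻ p in Prod.swap ⁻¹' S, k p = ∫⁻ p in S, k p := by
    have hSm' : MeasurableSet (Prod.swap ⁻¹' S) := measurable_swap hSm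
    rw [← lintegral_indicator hSm, ← lintegral_indicator hSm', Measure.volume_eq_prod,
      ← lintegral_prod_swap]
    refine lintegral_congr fun p => ?_
    have hkp : k p.swap = k p := by
      simp only [hk, Prod.fst_swap, Prod.snd_swap]
      rw [← hKe, neg_sub]
    by_cases hp : p ∈ S
    · rw [indicator_of_mem hp, indicator_of_mem (show p.swap ∈ Prod.swap ⁻¹' S by simpa using hp),
        hkp]
    · rw [indicator_of_notMem hp,
        indicator_of_notMem (show p.swap ∉ Prod.swap ⁻¹' S by simpa using hp)]
  have hmain : ∫⁻ p in S, k p = ∫⁻ h, ENNReal.ofReal (K h) * volume (separatedSet E r h) := by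
    have hg : Measurable (S.indicator k) := hkm.indicator hSm
    rw [← lintegral_indicator hSm, Measure.volume_eq_prod, lintegral_prod _ hg.aemeasurable]
    have h1 : ∀ x : Rn n, ∫⁻ y, S.indicator k (x, y) = ∫⁻ h, S.indicator k (x, x + h) := fun x =>
      (lintegral_add_left_eq_self (fun y => S.indicator k (x, y)) x).symm
    simp_rw [h1]
    have hg' : Measurable (fun p : Rn n × Rn n => S.indicator k (p.1, p.1 + p.2)) :=
      hg.comp (measurable_fst.prodMk (measurable_fst.add measurable_snd))
    rw [lintegral_lintegral_swap hg'.aemeasurable]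
    refine lintegral_congr fun h => ?_
    have hm : MeasurableSet (separatedSet E r h) := by
      have : separatedSet E r h = (fun x => (x, x + h)) ⁻¹' S := by
        ext x
        simp only [separatedSet, hS, mem_preimage, mem_inter_iff, mem_prod, mem_univ, and_true,
          hDmem, mem_ofPred_eq]
      rw [this]
      exact (measurable_id.prodMk (measurable_id.add_const h)) hSm
    rw [← setLIntegral_const, ← lintegral_indicator hm]
    refine lintegral_congr fun x => ?_
    have hiff : (x, x + h) ∈ S ↔ x ∈ separatedSet E r h := by
      simp only [separatedSet, hS, mem_inter_iff, mem_prod, mem_univ, and_true,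
          hDmem, mem_ofPred_eq]
    by_cases hx : x ∈ separatedSet E r h
    · rw [indicator_of_mem hx, indicator_of_mem (hiff.2 hx)]
      simp only [hk]
      rw [← hKe]
      congr 2
      abel
    · rw [indicator_of_notMem hx, indicator_of_notMem fun h' => hx (hiff.1 h')]
  rw [kPerimeter_eq_setLIntegral hK hb hE]
  refine (lintegral_mono_set hsub).trans ((lintegral_union_le _ _ _).trans ?_)
  rw [hswap, hmain, two_mul]

/-- Split at |h| = R - r. For shorter h, x in B_r forces x + h in B_R and the jump bound applies;
for longer h the volume is bounded by that of B_4 and the kernel tail is integrable. -/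
theorem exists_kPerimeter_le_of_volume_jumpSet_le [Nontrivial (Rn n)] (hs : 0 < s) (hs₁ : s < 1)
    (hlam : 0 < lam) (hLam : lam ≤ Lam) :
    ∃ C : ℝ, 0 < C ∧ ∀ K : Rn n → ℝ, KernelClassL2 s lam Lam K → ∀ E : Set (Rn n),
      MeasurableSet E → ∀ r R : ℝ, r < R → R ≤ 4 → R - r ≤ 1 →
      ∀ w : ℝ, 0 ≤ w → (∀ h, volume (jumpSet E R h) ≤ ENNReal.ofReal (w * ‖h‖)) →
      kPerimeter K (Metric.ball 0 r) E ≤ ENNReal.ofReal (C * (w + ((R - r) ^ (n + 1))⁻¹)) := by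
  have hLam0 : 0 < Lam := hlam.trans_le hLam
  set I₁ := ∫⁻ h in Metric.ball (0 : Rn n) 1, ENNReal.ofReal (‖h‖ ^ (-((n : ℝ) + s - 1))) with hI₁
  set I₂ := ∫⁻ h : Rn n, ENNReal.ofReal ((1 + ‖h‖) ^ (-((n : ℝ) + s))) with hI₂
  set V := volume (Metric.ball (0 : Rn n) 4) with hV
  have hI₁f : I₁ ≠ ∞ := (lintegral_norm_rpow_ball_lt_top hs₁).ne
  have hI₂f : I₂ ≠ ∞ := (lintegral_one_add_norm_rpow_lt_top hs).ne
  have hVf : V ≠ ∞ := measure_ball_lt_top.ne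
  set C := 2 * (Lam * I₁.toReal) + 2 * (Lam * 2 ^ (n + 1) * I₂.toReal * V.toReal) + 1 with hC
  refine ⟨C, by positivity, ?_⟩
  intro K hK E hEm r R hrR hR hd1 w hw hjump
  have hKm := hK.measurable hs hlam
  have hd : 0 < R - r := sub_pos.2 hrR
  set d := R - r with hdd
  have hdn : 0 < (d ^ (n + 1))⁻¹ := by positivity
  set q : ℝ := (n : ℝ) + s with hq
  have hq0 : 0 < q := by positivity
  have hpt : ∀ h : Rn n, ENNReal.ofReal (K h) * volume (separatedSet E r h) ≤
      ENNReal.ofReal (Lam * w) *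
        (Metric.ball (0 : Rn n) 1).indicator (fun h => ENNReal.ofReal (‖h‖ ^ (-(q - 1)))) h +
      ENNReal.ofReal (Lam * 2 ^ (n + 1) * (d ^ (n + 1))⁻¹) * V *
        ENNReal.ofReal ((1 + ‖h‖) ^ (-q)) := by
    intro h
    rcases eq_or_ne h 0 with rfl | hh
    · have : separatedSet E r 0 = ∅ := by simp [separatedSet]
      simp [this]
    have hh0 : 0 < ‖h‖ := norm_pos_iff.2 hh
    have hKh : K h ≤ Lam * ‖h‖ ^ (-q) := by
      rw [Real.rpow_neg hh0.le, ← div_eq_mul_inv]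
      exact hK.upper h hh
    by_cases hhd : ‖h‖ < d
    · refine le_trans ?_ le_self_add
      rw [indicator_of_mem (mem_ball_zero_iff.2 (hhd.trans_le hd1))]
      have h1 : separatedSet E r h ⊆ jumpSet E R h := by
        rintro x ⟨hx, hx'⟩
        refine ⟨Metric.ball_subset_ball hrR.le hx, ?_, hx'⟩
        rw [mem_ball_zero_iff] at hx ⊢
        linarith [norm_add_le x h]
      refine (mul_le_mul' (ENNReal.ofReal_le_ofReal hKh) ((measure_mono h1).trans (hjump h))).trans
        (le_of_eq ?_)
      rw [← ENNReal.ofReal_mul (by positivity), ← ENNReal.ofReal_mul (by positivity)]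
      congr 1
      rw [show -(q - 1) = -q + 1 by ring, Real.rpow_add_one hh0.ne']
      ring
    · refine le_trans ?_ le_add_self
      have hhd' : d ≤ ‖h‖ := not_lt.1 hhd
      have h1 : separatedSet E r h ⊆ Metric.ball 0 4 := fun x hx =>
        Metric.ball_subset_ball (by linarith) hx.1
      -- Since d ≤ 1 and d ≤ ‖h‖, d(1 + ‖h‖)/2 ≤ ‖h‖; the exponent q is then rounded up to n + 1 on
      -- the power of d / 2.
      have h2 : ‖h‖ ^ (-q) ≤ 2 ^ (n + 1) * (d ^ (n + 1))⁻¹ * (1 + ‖h‖) ^ (-q) := by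
        have h3 : d / 2 * (1 + ‖h‖) ≤ ‖h‖ := by nlinarith
        have h4 : ‖h‖ ^ (-q) ≤ (d / 2 * (1 + ‖h‖)) ^ (-q) :=
          Real.rpow_le_rpow_of_nonpos (by positivity) h3 (by linarith)
        rw [Real.mul_rpow (by positivity) (by positivity)] at h4
        refine h4.trans ?_
        gcongr
        have h5 : (d / 2) ^ (-q) ≤ (d / 2) ^ (-((n + 1 : ℕ) : ℝ)) := by
          refine Real.rpow_le_rpow_of_exponent_ge (by positivity) (by linarith) ?_
          push_cast
          linarith
        refine h5.trans (le_of_eq ?_)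
        rw [Real.rpow_neg (by positivity), Real.rpow_natCast, div_pow, inv_div, div_eq_mul_inv]
      have h6 : K h ≤ Lam * 2 ^ (n + 1) * (d ^ (n + 1))⁻¹ * (1 + ‖h‖) ^ (-q) := by
        refine hKh.trans ?_
        calc Lam * ‖h‖ ^ (-q) ≤ Lam * (2 ^ (n + 1) * (d ^ (n + 1))⁻¹ * (1 + ‖h‖) ^ (-q)) := by
              gcongr
          _ = _ := by ring
      refine (mul_le_mul' (ENNReal.ofReal_le_ofReal h6) (measure_mono h1)).trans (le_of_eq ?_)
      rw [ENNReal.ofReal_mul (by positivity)]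
      ring
  have hm₁ : Measurable ((Metric.ball (0 : Rn n) 1).indicator
      (fun h => ENNReal.ofReal (‖h‖ ^ (-(q - 1))))) :=
    (measurable_norm.pow_const _).ennreal_ofReal.indicator Metric.isOpen_ball.measurableSet
  have hm₂ : Measurable fun h : Rn n => ENNReal.ofReal ((1 + ‖h‖) ^ (-q)) :=
    ((measurable_norm.const_add 1).pow_const _).ennreal_ofReal
  refine (kPerimeter_le_lintegral_separatedSet hKm hK.even hEm r).trans ?_
  have hint := lintegral_mono (μ := volume) hpt
  rw [lintegral_add_left (hm₁.const_mul _), lintegral_const_mul _ hm₁, lintegral_const_mul _ hm₂,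
    lintegral_indicator Metric.isOpen_ball.measurableSet, ← hI₁, ← hI₂] at hint
  refine (mul_le_mul_right hint 2).trans ?_
  rw [← ENNReal.ofReal_toReal hI₁f, ← ENNReal.ofReal_toReal hI₂f, ← ENNReal.ofReal_toReal hVf,
    ← ENNReal.ofReal_mul (by positivity), ← ENNReal.ofReal_mul (by positivity),
    ← ENNReal.ofReal_mul (by positivity), ← ENNReal.ofReal_add (by positivity) (by positivity),
    show (2 : ℝ≥0∞) = ENNReal.ofReal 2 by norm_num, ← ENNReal.ofReal_mul (by norm_num)]
  refine ENNReal.ofReal_le_ofReal ?_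
  have e1 : 2 * (Lam * w * I₁.toReal +
      Lam * 2 ^ (n + 1) * (d ^ (n + 1))⁻¹ * V.toReal * I₂.toReal) =
      2 * (Lam * I₁.toReal) * w + 2 * (Lam * 2 ^ (n + 1) * I₂.toReal * V.toReal) *
        (d ^ (n + 1))⁻¹ := by ring
  rw [e1, mul_add]
  have hx₁ : 0 ≤ 2 * (Lam * I₁.toReal) := by positivity
  have hx₂ : 0 ≤ 2 * (Lam * 2 ^ (n + 1) * I₂.toReal * V.toReal) := by positivity
  gcongr
  · rw [hC]; linarith
  · rw [hC]; linarith

/-- A linear bound, uniform in all directions, for the volume of the jump sets of `E` in `B_r`. -/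
def HasJumpBound (E : Set (Rn n)) (r v : ℝ) : Prop :=
  ∀ h, volume (jumpSet E r h) ≤ ENNReal.ofReal (v * ‖h‖)

theorem HasJumpBound.mono {E : Set (Rn n)} {r r' v v' : ℝ} (h : HasJumpBound E r' v')
    (hr : r ≤ r') (hv : v' ≤ v) : HasJumpBound E r v := fun x =>
  (measure_mono (jumpSet_mono E hr x)).trans
    ((h x).trans (ENNReal.ofReal_le_ofReal (by gcongr)))

/-! ### Absorption -/

/-- The two conversions are chained through the ball of radius (r + R)/2. The power n + 3 adds n + 1
from the kernel tail to 2 from the gradient of the cutoff. -/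
theorem exists_hasJumpBound_step [Nontrivial (Rn n)] (hs : 0 < s) (hs₁ : s < 1)
    (hlam : 0 < lam) (hLam : lam ≤ Lam) :
    ∃ C : ℝ, 0 < C ∧ ∀ K : Rn n → ℝ, KernelClassL2 s lam Lam K → ∀ E : Set (Rn n),
      MeasurableSet E → IsShearStable K E → ∀ r R : ℝ, 1 ≤ r → r < R → R ≤ 4 → R - r ≤ 1 →
      ∀ w : ℝ, 0 ≤ w → HasJumpBound E R w →
      ∀ v : ℝ, 0 ≤ v → C * (1 + w) * ((R - r) ^ (n + 3))⁻¹ ≤ v ^ 2 → HasJumpBound E r v := by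
  obtain ⟨A, hA, hA'⟩ := exists_volume_jumpSet_le_of_kPerimeter_le (n := n) hs hlam hLam
  obtain ⟨B, hB, hB'⟩ := exists_kPerimeter_le_of_volume_jumpSet_le (n := n) hs hs₁ hlam hLam
  refine ⟨A * (1 + B * 2 ^ (n + 3)), by positivity, ?_⟩
  intro K hK E hEm hE r R hr hrR hR hd1 w hw hJ v hv hCv
  have hd : 0 < R - r := sub_pos.2 hrR
  have hP := hB' K hK E hEm ((r + R) / 2) R (by linarith) hR (by linarith) w hw hJ
  refine hA' K hK E hEm hE r ((r + R) / 2) hr (by linarith) (by linarith) _ (by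
    have : 0 < R - (r + R) / 2 := by linarith
    positivity) hP v hv (le_trans ?_ hCv)
  have e1 : R - (r + R) / 2 = (R - r) / 2 := by ring
  have e2 : (r + R) / 2 - r = (R - r) / 2 := by ring
  rw [e1, e2]
  set d := R - r
  have hD : 1 ≤ (d ^ (n + 3))⁻¹ := (one_le_inv₀ (by positivity)).2 (pow_le_one₀ hd.le hd1)
  have h1 : B * (w + ((d / 2) ^ (n + 1))⁻¹) / (d / 2) ^ 2 ≤
      B * 2 ^ (n + 3) * (1 + w) * (d ^ (n + 3))⁻¹ := by
    have h2 : w * ((d / 2) ^ 2)⁻¹ ≤ w * ((d / 2) ^ (n + 3))⁻¹ := by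
      gcongr w * ?_
      refine inv_anti₀ (by positivity) ?_
      exact pow_le_pow_of_le_one (by positivity) (by linarith) (by omega)
    calc B * (w + ((d / 2) ^ (n + 1))⁻¹) / (d / 2) ^ 2
        = B * (w * ((d / 2) ^ 2)⁻¹ + ((d / 2) ^ (n + 3))⁻¹) := by
          rw [show n + 3 = n + 1 + 2 by ring, pow_add (d / 2) (n + 1) 2, mul_inv]; ring
      _ ≤ B * (w * ((d / 2) ^ (n + 3))⁻¹ + ((d / 2) ^ (n + 3))⁻¹) := by gcongr
      _ = _ := by rw [div_pow, inv_div, div_eq_mul_inv]; ring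
  calc A * (1 + B * (w + ((d / 2) ^ (n + 1))⁻¹) / (d / 2) ^ 2)
      ≤ A * ((1 + w) * (d ^ (n + 3))⁻¹ + B * 2 ^ (n + 3) * (1 + w) * (d ^ (n + 3))⁻¹) := by
        gcongr
        nlinarith
    _ = _ := by ring

theorem exists_hasJumpBound_one [Nontrivial (Rn n)] (hs : 0 < s) (hs₁ : s < 1)
    (hlam : 0 < lam) (hLam : lam ≤ Lam) :
    ∃ C : ℝ, 0 ≤ C ∧ ∀ K : Rn n → ℝ, KernelClassL2 s lam Lam K → ∀ E : Set (Rn n),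
      MeasurableSet E → IsShearStable K E → HasJumpBound E 1 C := by
  obtain ⟨A, hA, hA'⟩ := exists_volume_jumpSet_le_of_kPerimeter_le (n := n) hs hlam hLam
  obtain ⟨C, hC, hC'⟩ := exists_hasJumpBound_step (n := n) hs hs₁ hlam hLam
  set m := n + 3 with hm
  set a : ℝ := C * 4 ^ m + 1 with ha
  have ha1 : 1 ≤ a := by rw [ha]; linarith [show 0 < C * 4 ^ m by positivity]
  refine ⟨2 * a + 1, by positivity, fun K hK E hEm hE => ?_⟩
  -- The weight blows up at r = 2 at the rate that makes both sides of the step inequality scale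
  -- like the same power of 2 - r.
  let T : Set ℝ := {S | 0 ≤ S ∧ ∀ r, 1 ≤ r → r < 2 → HasJumpBound E r (S * ((2 - r) ^ m)⁻¹)}
  have hT0 : T.Nonempty := by
    -- Finiteness of the perimeter gives some bound depending on E; it serves only to make T
    -- nonempty.
    set p := (kPerimeter K (Metric.ball 0 4) E).toReal with hp
    have hp0 : 0 ≤ p := ENNReal.toReal_nonneg
    set q := A * (1 + p / (4 - 2) ^ 2) + 1 with hq
    have hq0 : 0 ≤ A * (1 + p / (4 - 2) ^ 2) := by positivity
    have h2 : HasJumpBound E 2 q := hA' K hK E hEm hE 2 4 (by norm_num) (by norm_num) le_rfl p hp0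
      (ENNReal.ofReal_toReal hE.1.ne).ge q (by linarith) (by rw [hq]; nlinarith)
    refine ⟨q, by linarith, fun r hr1 hr2 => h2.mono hr2.le ?_⟩
    have hD : 1 ≤ ((2 - r) ^ m)⁻¹ :=
      (one_le_inv₀ (by have := sub_pos.2 hr2; positivity)).2 (pow_le_one₀ (by linarith) (by linarith))
    exact le_mul_of_one_le_right (by linarith) hD
  have hbdd : BddBelow T := ⟨0, fun S hS => hS.1⟩
  have hstep : ∀ S ∈ T, S / 2 + a ∈ T := by
    rintro S ⟨hS0, hS⟩
    refine ⟨by positivity, fun r hr1 hr2 => ?_⟩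
    set d := (2 - r) / 2 with hd
    have hd0 : 0 < d := by rw [hd]; linarith
    have hD : 1 ≤ (d ^ m)⁻¹ :=
      (one_le_inv₀ (by positivity)).2 (pow_le_one₀ hd0.le (by rw [hd]; linarith))
    have hJ := hS (r + d) (by linarith) (by rw [hd]; linarith)
    have e1 : 2 - (r + d) = d := by rw [hd]; ring
    have e2 : 2 - r = 2 * d := by rw [hd]; ring
    rw [e1] at hJ
    have hd4 : r + d ≤ 4 := by rw [hd]; linarith
    have hd1 : r + d - r ≤ 1 := by rw [hd]; linarith
    refine hC' K hK E hEm hE r (r + d) hr1 (by linarith) hd4 hd1 _ (by positivity) hJ _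
      (by rw [e2]; positivity) ?_
    rw [e2, add_sub_cancel_left, mul_pow (2 : ℝ), mul_inv (2 ^ m : ℝ)]
    set D := (d ^ m)⁻¹
    have h4 : (4 : ℝ) ^ m = 2 ^ m * 2 ^ m := by rw [← mul_pow]; norm_num
    -- Absorption: as a ≥ 1, the square S²/4 + aS + a² dominates a(1 + S). The factor 4 ^ m pays for
    -- halving the distance to 2.
    have h5 : C * 4 ^ m * (1 + S) ≤ (S / 2 + a) ^ 2 := by
      have : C * 4 ^ m * (1 + S) ≤ a * (1 + S) := by
        gcongr
        linarith
      nlinarith [sq_nonneg S]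
    calc C * (1 + S * D) * D ≤ C * ((1 + S) * D) * D := by gcongr; nlinarith
      _ = C * 4 ^ m * (1 + S) * ((2 ^ m)⁻¹ * D) ^ 2 := by
        rw [h4]; field_simp
      _ ≤ (S / 2 + a) ^ 2 * ((2 ^ m)⁻¹ * D) ^ 2 := by gcongr
      _ = _ := by ring
  -- T is stable under S ↦ S/2 + a, whose fixed point is 2a, so its infimum cannot exceed 2a.
  have hinf : sInf T ≤ 2 * a := by
    have : 2 * (sInf T - a) ≤ sInf T := le_csInf hT0 fun S hS => by
      have := csInf_le hbdd (hstep S hS)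
      linarith
    linarith
  obtain ⟨S, hS, hlt⟩ := exists_lt_of_csInf_lt hT0 (show sInf T < 2 * a + 1 by linarith)
  have := hS.2 1 le_rfl (by norm_num)
  refine this.mono le_rfl ?_
  norm_num
  linarith

/-! ### From the jump sets to the total variation -/

theorem measurableSet_jumpSet {E : Set (Rn n)} (hE : MeasurableSet E) (r : ℝ) (h : Rn n) :
    MeasurableSet (jumpSet E r h) := by
  have hb : MeasurableSet (Metric.ball (0 : Rn n) r) := Metric.isOpen_ball.measurableSet
  have ht : Measurable fun x : Rn n => x + h := measurable_id.add_const h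
  have : jumpSet E r h = Metric.ball 0 r ∩ (fun x => x + h) ⁻¹' Metric.ball 0 r ∩
      ((E \ (fun x => x + h) ⁻¹' E) ∪ ((fun x => x + h) ⁻¹' E \ E)) := by
    ext x
    simp only [jumpSet, mem_ofPred_eq, mem_inter_iff, mem_union, mem_sdiff, mem_preimage]
    tauto
  rw [this]
  exact (hb.inter (ht hb)).inter ((hE.diff (ht hE)).union ((ht hE).diff hE))

theorem indicator_inter_apply_of_mem {E S : Set (Rn n)} {x : Rn n} (hx : x ∈ S) :
    (E ∩ S).indicator (fun _ => (1 : ℝ)) x = E.indicator (fun _ => (1 : ℝ)) x := by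
  by_cases hxE : x ∈ E <;> simp [hx, hxE]

/-- The derivative is a limit of difference quotients, which a translation moves onto the indicator.
On the support of f the shifted difference vanishes off a jump set of volume at most v t, cancelling
the factor 1/t. -/
theorem HasJumpBound.integral_lineDeriv_mul_le {E : Set (Rn n)} (hE : MeasurableSet E) {r v : ℝ}
    (hv : HasJumpBound E r v) (hv0 : 0 ≤ v) {f : Rn n → ℝ} {C : ℝ≥0} (hf : LipschitzWith C f)
    (hf1 : ∀ x, |f x| ≤ 1) (hfc : HasCompactSupport f) (hfs : tsupport f ⊆ Metric.ball 0 r)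
    {e : Rn n} (he : ‖e‖ = 1) :
    ∫ x, lineDeriv ℝ f x e * (E ∩ Metric.ball 0 r).indicator (fun _ => (1 : ℝ)) x ≤ v := by
  set g : Rn n → ℝ := (E ∩ Metric.ball 0 r).indicator (fun _ => (1 : ℝ)) with hg
  have hb : MeasurableSet (Metric.ball (0 : Rn n) r) := Metric.isOpen_ball.measurableSet
  have hgi : Integrable g := (integrable_indicator_iff (hE.inter hb)).2
    (integrableOn_const (measure_ne_top_of_subset inter_subset_right measure_ball_lt_top.ne))
  have hlim := hf.integral_inv_smul_sub_mul_tendsto_integral_lineDeriv_mul hgi e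
  refine le_of_tendsto hlim ?_
  -- The margin δ keeps x - te in the ball for x in the support of f.
  obtain ⟨δ, hδ, hthick⟩ := hfc.isCompact.exists_thickening_subset_open Metric.isOpen_ball hfs
  filter_upwards [Ioo_mem_nhdsGT hδ] with t ht
  have ht0 : 0 < t := ht.1
  set w : Rn n := t • e with hw
  have hwn : ‖w‖ = t := by rw [hw, norm_smul, he, mul_one, Real.norm_of_nonneg ht0.le]
  have hfc' : Continuous f := hf.continuous
  have hi1 : Integrable fun x => f (x + w) * g x :=
    hgi.bdd_mul (c := 1) (hfc'.comp (continuous_id.add continuous_const)).aestronglyMeasurable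
      (Filter.Eventually.of_forall fun x => hf1 _)
  have hi2 : Integrable fun x => f x * g x :=
    hgi.bdd_mul (c := 1) hfc'.aestronglyMeasurable (Filter.Eventually.of_forall fun x => hf1 _)
  have hi3 : Integrable fun x => f x * g (x - w) :=
    (hgi.comp_sub_right w).bdd_mul (c := 1) hfc'.aestronglyMeasurable
      (Filter.Eventually.of_forall fun x => hf1 _)
  have e1 : ∫ x, f (x + w) * g x = ∫ x, f x * g (x - w) := by
    rw [← integral_add_right_eq_self (fun x => f x * g (x - w)) w]
    simp
  have e2 : ∫ x, (t⁻¹ • (f (x + w) - f x)) * g x = t⁻¹ * ∫ x, f x * (g (x - w) - g x) := by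
    have h1 : ∀ x, (t⁻¹ • (f (x + w) - f x)) * g x = t⁻¹ * (f (x + w) * g x - f x * g x) := by
      intro x; rw [smul_eq_mul]; ring
    simp_rw [h1, mul_sub (f _)]
    rw [integral_const_mul, integral_sub hi1 hi2, integral_sub hi3 hi2, e1]
  rw [e2]
  have hJm := measurableSet_jumpSet hE r (-w)
  have hJf : volume (jumpSet E r (-w)) ≠ ∞ := measure_ne_top_of_subset
    (fun x hx => hx.1) (measure_ball_lt_top (x := (0 : Rn n)) (r := r)).ne
  have hbound : ∀ x, ‖f x * (g (x - w) - g x)‖ ≤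
      (jumpSet E r (-w)).indicator (fun _ => (1 : ℝ)) x := by
    intro x
    by_cases hfx : f x = 0
    · rw [hfx, zero_mul, norm_zero]
      exact indicator_nonneg (fun _ _ => zero_le_one) _
    have hxs : x ∈ tsupport f := subset_tsupport _ hfx
    have hx1 : x ∈ Metric.ball (0 : Rn n) r := hfs hxs
    have hx2 : x - w ∈ Metric.ball (0 : Rn n) r := by
      refine hthick (Metric.mem_thickening_iff.2 ⟨x, hxs, ?_⟩)
      rw [dist_eq_norm, sub_sub_cancel_left, norm_neg, hwn]
      exact ht.2
    have hgx : g x = E.indicator (fun _ => (1 : ℝ)) x := indicator_inter_apply_of_mem hx1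
    have hgx' : g (x - w) = E.indicator (fun _ => (1 : ℝ)) (x - w) :=
      indicator_inter_apply_of_mem hx2
    rw [hgx, hgx', norm_mul]
    by_cases hJ : x ∈ jumpSet E r (-w)
    · rw [indicator_of_mem hJ]
      have h1 : ‖E.indicator (fun _ => (1 : ℝ)) (x - w) - E.indicator (fun _ => (1 : ℝ)) x‖ ≤ 1 := by
        by_cases h1 : x ∈ E <;> by_cases h2 : x - w ∈ E <;> simp [h1, h2]
      calc ‖f x‖ * _ ≤ 1 * 1 := by gcongr; exact hf1 x
        _ = 1 := one_mul 1
    · rw [indicator_of_notMem hJ]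
      have hiff : x ∈ E ↔ x - w ∈ E := by
        by_contra h
        exact hJ ⟨hx1, by rwa [← sub_eq_add_neg], by rwa [← sub_eq_add_neg]⟩
      by_cases h1 : x ∈ E
      · simp [h1, hiff.1 h1]
      · have h2 : x - w ∉ E := fun h => h1 (hiff.2 h)
        simp [h1, h2]
  have hint := norm_integral_le_of_norm_le ((integrable_indicator_iff hJm).2
    (integrableOn_const hJf)) (Filter.Eventually.of_forall hbound)
  rw [integral_indicator_const _ hJm, smul_eq_mul, mul_one] at hint
  have hJv : volume.real (jumpSet E r (-w)) ≤ v * t := by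
    have := hv (-w)
    rw [norm_neg, hwn] at this
    exact ENNReal.toReal_le_of_le_ofReal (by positivity) this
  have h2 := ((le_abs_self _).trans hint).trans hJv
  rw [inv_mul_le_iff₀ ht0]
  linarith

/-- Each component of a test field is itself bounded by 1, so the directional estimate applies to
the n coordinate directions separately. -/
theorem HasJumpBound.totalVariation_le {E : Set (Rn n)} (hE : MeasurableSet E) {r v : ℝ}
    (hv : HasJumpBound E r v) (hv0 : 0 ≤ v) :
    totalVariation (charFun E) (Metric.ball 0 r) ≤ ENNReal.ofReal (n * v) := by
  have hb : MeasurableSet (Metric.ball (0 : Rn n) r) := Metric.isOpen_ball.measurableSet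
  refine iSup₂_le fun φ hφ => ENNReal.ofReal_le_ofReal ?_
  set g : Rn n → ℝ := (E ∩ Metric.ball 0 r).indicator (fun _ => (1 : ℝ)) with hg
  have hgi : Integrable g := (integrable_indicator_iff (hE.inter hb)).2
    (integrableOn_const (measure_ne_top_of_subset inter_subset_right measure_ball_lt_top.ne))
  let f : Fin n → Rn n → ℝ := fun i x => φ x i
  have hfd : ∀ i, ContDiff ℝ 1 (f i) := fun i =>
    (EuclideanSpace.proj i : Rn n →L[ℝ] ℝ).contDiff.comp hφ.contDiff
  have hfsub : ∀ i, Function.support (f i) ⊆ Function.support φ := fun i x hx h0 => hx (by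
    simp only [f, h0]; rfl)
  have hfts : ∀ i, tsupport (f i) ⊆ tsupport φ := fun i => closure_mono (hfsub i)
  have hfc : ∀ i, HasCompactSupport (f i) := fun i =>
    hφ.compactSupport.of_isClosed_subset (isClosed_tsupport _) (hfts i)
  have hdiv : ∀ x, divergence φ x = ∑ i, lineDeriv ℝ (f i) x (EuclideanSpace.single i 1) := by
    intro x
    refine Finset.sum_congr rfl fun i _ => ?_
    have hd : DifferentiableAt ℝ φ x := hφ.contDiff.differentiable (by norm_num) x
    have h1 : HasFDerivAt (f i)
        ((EuclideanSpace.proj i : Rn n →L[ℝ] ℝ).comp (fderiv ℝ φ x)) x :=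
      (EuclideanSpace.proj i : Rn n →L[ℝ] ℝ).hasFDerivAt.comp x hd.hasFDerivAt
    rw [h1.differentiableAt.lineDeriv_eq_fderiv, h1.fderiv]
    rfl
  have hi : ∀ i ∈ (Finset.univ : Finset (Fin n)),
      Integrable fun x => lineDeriv ℝ (f i) x (EuclideanSpace.single i 1) * g x := by
    intro i _
    obtain ⟨C, hC⟩ := (hfd i).lipschitzWith_of_hasCompactSupport (hfc i) (by norm_num)
    refine hgi.bdd_mul (c := C * ‖EuclideanSpace.single i (1 : ℝ)‖)
      (measurable_lineDeriv (hfd i).continuous).aestronglyMeasurable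
      (Filter.Eventually.of_forall fun x => norm_lineDeriv_le_of_lipschitz ℝ hC)
  have e1 : ∫ x in Metric.ball (0 : Rn n) r, charFun E x * divergence φ x =
      ∑ i, ∫ x, lineDeriv ℝ (f i) x (EuclideanSpace.single i 1) * g x := by
    rw [← integral_finsetSum _ hi, ← integral_indicator hb]
    refine integral_congr_ae (Filter.Eventually.of_forall fun x => ?_)
    simp only [← Finset.sum_mul, ← hdiv]
    by_cases hx : x ∈ Metric.ball (0 : Rn n) r
    · rw [indicator_of_mem hx, hg, indicator_inter_apply_of_mem hx, mul_comm]
      rfl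
    · rw [indicator_of_notMem hx, hg, indicator_of_notMem (fun h => hx h.2), mul_zero]
  rw [e1]
  calc ∑ i, ∫ x, lineDeriv ℝ (f i) x (EuclideanSpace.single i 1) * g x ≤ ∑ _i : Fin n, v := by
        refine Finset.sum_le_sum fun i _ => ?_
        obtain ⟨C, hC⟩ := (hfd i).lipschitzWith_of_hasCompactSupport (hfc i) (by norm_num)
        refine hv.integral_lineDeriv_mul_le hE hv0 hC (fun x => ?_) (hfc i)
          ((hfts i).trans hφ.tsupport_subset) (by simp)
        exact (PiLp.norm_apply_le (φ x) i).trans (hφ.norm_le_one x)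
    _ = n * v := by simp

theorem charFun_congr_ae {E E' : Set (Rn n)} (h : E =ᵐ[volume] E') :
    charFun E =ᵐ[volume] charFun E' :=
  indicator_ae_eq_of_ae_eq_set h

theorem totalVariation_congr_ae {u u' : Rn n → ℝ} (h : u =ᵐ[volume] u') (Ω : Set (Rn n)) :
    totalVariation u Ω = totalVariation u' Ω := by
  unfold totalVariation
  refine iSup_congr fun φ => iSup_congr fun _ => ?_
  congr 1
  refine integral_congr_ae (ae_restrict_of_ae ?_)
  filter_upwards [h] with x hx
  rw [hx]

end NonlocalPerimeter

/-! ### The perimeter bound for stable sets -/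

theorem theorem1p3 (n : ℕ) (hn : 2 ≤ n) (s lam Lam : ℝ) (hs₀ : 0 < s) (hs₁ : s < 1)
    (hlam : 0 < lam) (hLam : lam ≤ Lam) :
    ∃ C : ℝ≥0, ∀ K : NonlocalPerimeter.Rn n → ℝ, NonlocalPerimeter.KernelClassL2 s lam Lam K →
      ∀ E : Set (NonlocalPerimeter.Rn n), NullMeasurableSet E volume →
        NonlocalPerimeter.IsStableSet K (Metric.ball 0 4) E →
          NonlocalPerimeter.MemBV (NonlocalPerimeter.charFun E) (Metric.ball 0 1) ∧
            NonlocalPerimeter.perimeter (Metric.ball 0 1) E ≤ (C : ℝ≥0∞) := by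
  have : Nonempty (Fin n) := ⟨⟨0, by omega⟩⟩
  have : Nontrivial (NonlocalPerimeter.Rn n) := inferInstance
  obtain ⟨C, hC, H⟩ := NonlocalPerimeter.exists_hasJumpBound_one (n := n) hs₀ hs₁ hlam hLam
  refine ⟨(n * C).toNNReal, fun K hK E hE hst => ?_⟩
  -- E is replaced by an almost equal measurable set; shears preserve null sets, so shear stability
  -- passes to it.
  obtain ⟨E', hE'm, hEE'⟩ := hE
  have hJ := H K hK E' hE'm (hst.isShearStable_congr hEE')
  have hchar := NonlocalPerimeter.charFun_congr_ae hEE'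
  have hTV : NonlocalPerimeter.totalVariation (NonlocalPerimeter.charFun E) (Metric.ball 0 1) ≤
      ENNReal.ofReal (n * C) := by
    rw [NonlocalPerimeter.totalVariation_congr_ae hchar]
    exact hJ.totalVariation_le hE'm hC
  refine ⟨⟨?_, hTV.trans_lt ENNReal.ofReal_lt_top⟩, hTV⟩
  have h1 : IntegrableOn (NonlocalPerimeter.charFun E') (Metric.ball 0 1) :=
    (integrableOn_const measure_ball_lt_top.ne).indicator hE'm
  exact h1.congr (ae_restrict_of_ae hchar.symm)
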